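/- \textbf{Setting.} A line network has $L$ links in tandem, joining nodes $v_0$ (source), $v_1,\dots,v_L$ (sink). At each time $1,2,3,\dots$ every non-sink node sends one packet over its outgoing link. A packet sent over the $i$-th link is received (without delay) with probability $p_i\in(0,1]$ and lost otherwise, independently over links and times (the \emph{traffic}). The source has $k$ message vectors over $\mathbb F_2$, divided into $q$ disjoint chunks of size $k/q$ each (so $q\mid k$). In a (random) \emph{chunked code} with $q$ chunks each node, at each transmission, chooses one of the $q$ chunks uniformly at random and sends a random $\mathbb F_2$-linear combination, with independent uniform coefficients, of the message vectors of that chunk (the source), respectively of the packets of that chunk which it has previously received (an interior node); all these choices are independent of each other and of the traffic. The sink can decode a chunk once it has received $k/q$ packets of that chunk with linearly independent global encoding vectors. The \emph{coding delay} is the first time at which the sink can decode all $q$ chunks; the \emph{average coding delay} of a code is the expectation of the coding delay over the traffic, for a fixed code, and so is a random variable depending on the random code. Below, $\log=\log_2$. \textbf{Theorem.} Consider a sequence of such networks and chunked codes with $k\to\infty$, where $L\ge 1$, $q$, the parameters $p_1,\dots,p_L\in(0,1]$ and $\epsilon\in(0,1)$ are arbitrary and may vary along the sequence. Put $p=\min_{1\le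 i\le L}p_i$. Suppose that $$q=o\!\left(\frac{k}{L\log (kL/\epsilon)}\right),\qquad w\sim\left(\frac{kL}{q\log(kL/\epsilon)}\right)^{1/2},$$ that is, the ratios of the two sides tend to $0$ and to $1$, respectively, as $k\to\infty$. Then there is a sequence $o(1)$ that tends to $0$ as $k\to\infty$ such that, for all sufficiently large $k$, the average coding delay of a random chunked code with $q$ chunks is larger than $$\frac1p\left(k+(1+o(1))\left(\frac{kL}{w}+wq\log\frac{wqL}{\epsilon}\right)\right)$$ with probability at most $\epsilon$. -/

import Mathlib

open MeasureTheory ProbabilityTheory Filter Topology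
open scoped ENNReal

/-- A traffic with deterministic regular transmissions on a line network with links `0, …, L - 1`
(link `i` goes from node `i` to node `i + 1`). Over every link a packet is sent at each of the times
`1, 2, 3, …`; the transmission with label `t : ℕ` is the one at time `t + 1`.
`τ (i, t) = true` means that this packet is received, `false` that it is lost. -/
abbrev Traffic (L : ℕ) : Type := Fin L × ℕ → Bool

/-- Bernoulli losses: all transmissions succeed independently, over link `i` with
probability `p i`. -/
noncomputable def trafficLaw {L : ℕ} (p : Fin L → unitInterval) : Measure (Traffic L) :=
  Measure.infinitePi fun x : Fin L × ℕ => bernoulliMeasure true false (p x.1)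

/-- All the random choices made by a chunked code with `q` chunks, each of `α` message vectors, on a
line network with `L` links: the chunk chosen at every transmission, the coefficients used by the
source, and the local encoding coefficients used by the interior nodes. -/
structure ChunkedCode (L q α : ℕ) where
  /-- `chunk (i, t)` is the chunk chosen for transmission `t` over link `i`. -/
  chunk : Fin L × ℕ → Fin q
  /-- `src (t, j)` is the coefficient of the `j`-th message vector of the chosen chunk in the packet
  sent by the source in transmission `t`. -/
  src : ℕ × Fin α → ZMod 2
  /-- `loc (i, t, s)` is the coefficient, in transmission `t` over the (non-first) link `i`, of the
  packet with label `s` of the preceding link. It is used only if that packet was received earlier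
  and pertains to the chosen chunk. -/
  loc : Fin L × ℕ × ℕ → ZMod 2

/-- Codes as triples, to transport the product σ-algebra and the product measure. -/
def ChunkedCode.ofTriple {L q α : ℕ}
    (x : (Fin L × ℕ → Fin q) × (ℕ × Fin α → ZMod 2) × (Fin L × ℕ × ℕ → ZMod 2)) :
    ChunkedCode L q α :=
  ⟨x.1, x.2.1, x.2.2⟩

instance (L q α : ℕ) : MeasurableSpace (ChunkedCode L q α) :=
  MeasurableSpace.map ChunkedCode.ofTriple inferInstance

/-- The law of a random chunked code: all choices are independent, each chunk is uniform among the
`q` chunks, and each coefficient is uniform in the field with two elements. -/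
noncomputable def codeLaw (L q α : ℕ) : Measure (ChunkedCode L q α) :=
  Measure.map ChunkedCode.ofTriple
    ((Measure.infinitePi fun _ : Fin L × ℕ => uniformOn (Set.univ : Set (Fin q))).prod
      ((Measure.infinitePi fun _ : ℕ × Fin α => uniformOn (Set.univ : Set (ZMod 2))).prod
        (Measure.infinitePi fun _ : Fin L × ℕ × ℕ => uniformOn (Set.univ : Set (ZMod 2)))))

/-- The global encoding vector of the packet sent in transmission `t` over link `i`, that is, its
coefficients with respect to the `α` message vectors of its chunk `c.chunk (i, t)` (its coefficients
on the message vectors of the other chunks are zero). The source combines all message vectors of the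
chunk; an interior node combines the packets of the chunk that it received before. -/
def encVec {L q α : ℕ} (c : ChunkedCode L q α) (τ : Traffic L) :
    (i : ℕ) → i < L → ℕ → (Fin α → ZMod 2)
  | 0, _, t => fun j => c.src (t, j)
  | i + 1, h, t =>
      ∑ s ∈ Finset.range t,
        if τ (⟨i, Nat.lt_of_succ_lt h⟩, s) = true ∧
            c.chunk (⟨i, Nat.lt_of_succ_lt h⟩, s) = c.chunk (⟨i + 1, h⟩, t)
        then c.loc (⟨i + 1, h⟩, t, s) • encVec c τ i (Nat.lt_of_succ_lt h) s
        else 0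

/-- The span of the global encoding vectors of the packets pertaining to chunk `b` that the sink
(the end of the last link) has received up to and including time `N`. -/
def sinkSpan {L q α : ℕ} (c : ChunkedCode L q α) (τ : Traffic L) (b : Fin q) (N : ℕ) :
    Submodule (ZMod 2) (Fin α → ZMod 2) :=
  Submodule.span (ZMod 2)
    {v | ∃ i : Fin L, (i : ℕ) + 1 = L ∧ ∃ t < N,
      τ (i, t) = true ∧ c.chunk (i, t) = b ∧ v = encVec c τ i i.isLt t}

/-- At time `N` the sink can decode every chunk: for each chunk it has received `α` packets with
linearly independent global encoding vectors. -/
def DecodedBy {L q α : ℕ} (c : ChunkedCode L q α) (τ : Traffic L) (N : ℕ) : Prop :=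
  ∀ b : Fin q, Module.finrank (ZMod 2) (sinkSpan c τ b N) = α

/-- The coding delay: the first time at which the sink can decode all the message vectors
(`∞` if this never happens). -/
noncomputable def codingDelay {L q α : ℕ} (c : ChunkedCode L q α) (τ : Traffic L) : ℝ≥0∞ :=
  ⨅ (N : ℕ) (_ : DecodedBy c τ N), (N : ℝ≥0∞)

/-- The average coding delay of a code with respect to the Bernoulli traffics with parameters `p`:
the coding delay averaged over the traffic, but not over the code. -/
noncomputable def averageCodingDelay {L q α : ℕ} (p : Fin L → unitInterval)
    (c : ChunkedCode L q α) : ℝ≥0∞ :=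
  ∫⁻ τ, codingDelay c τ ∂(trafficLaw p)

theorem ChunkedCode.measurable_ofTriple {L q α : ℕ} :
    Measurable (ChunkedCode.ofTriple (L := L) (q := q) (α := α)) :=
  fun _ hs => hs

instance {L : ℕ} (p : Fin L → unitInterval) : IsProbabilityMeasure (trafficLaw p) := by
  unfold trafficLaw
  infer_instance

/-- As soon as there is a chunk, `codeLaw` is indeed a probability measure. -/
theorem isProbabilityMeasure_codeLaw {L q α : ℕ} (hq : 0 < q) :
    IsProbabilityMeasure (codeLaw L q α) := by
  have : Nonempty (Fin q) := ⟨⟨0, hq⟩⟩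
  have : IsProbabilityMeasure (uniformOn (Set.univ : Set (Fin q))) :=
    isProbabilityMeasure_uniformOn Set.finite_univ Set.univ_nonempty
  have : IsProbabilityMeasure (uniformOn (Set.univ : Set (ZMod 2))) :=
    isProbabilityMeasure_uniformOn Set.finite_univ Set.univ_nonempty
  exact Measure.isProbabilityMeasure_map ChunkedCode.measurable_ofTriple.aemeasurable

/-! Write α = k/q. The sink fails to decode a chunk exactly when all the encoding vectors it holds
are orthogonal to some nonzero x. Follow the last node aware of x. Whenever it sends a packet of the
chunk that is received, one fresh uniform coefficient makes the packet orthogonal to x with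
conditional probability 1/2, so this frontier stays or advances with probability 1/2 each. With
chunk choices and losses frozen, the law of the frontier is therefore bounded by a sum over lattice
paths, with a factor 1/2 for every received packet met (`coefLaw_awareFrontier_le`).

A union bound over 2^α vectors, averaged directly over chunks and losses, is too lossy: atypical
receptions dominate. Instead the frozen failure probability P is first replaced by P^η ≥ P with 0 <
η ≤ 1. This turns 1/2 into θ = 2^(-η) and 2^α into θ^(-α) (`coefLaw_exists_not_aware_le`). Averaged
and weighted by z^i at node i, the path weights grow per time step by at most ρ = 1 - (p/q)(1 -
θ(1+z)) (`pow_mul_lintegral_pathWeight_le`), so a chunk fails at time N with probability at most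
z^(-(L-1)) θ^(-α) ρ^N. Summing over later times controls the average delay, and Markov's inequality
over the code gives a tail bound.

With z = 1/α, θ(1+z) = α/(α+y) and N about (α+y)q/p, the tail is at most k^L exp(1 - y²/(2(α+y)))
(`codeLaw_averageCodingDelay_le_of_sq`). For S = √(αL log(kL/ε)), any y slightly above √(2 ln 2) S ≈
1.18 S suffices. The stated bound leaves room for 1.3 S: kL/w is about qS, and the other term is at
least about qS/3. Hence the o(1) can be taken to be 0. -/

/-! ### Resampling one coordinate of a product measure -/

section Resampling

variable {ι : Type*} [DecidableEq ι] {X : ι → Type*} {mX : ∀ i, MeasurableSpace (X i)}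
  (μ : ∀ i, Measure (X i)) [hμ : ∀ i, IsProbabilityMeasure (μ i)]

/-- Resampling one coordinate preserves a product measure. -/
theorem measurePreserving_update_infinitePi (j : ι) :
    MeasurePreserving (fun y : (∀ i, X i) × X j => Function.update y.1 j y.2)
      ((Measure.infinitePi μ).prod (μ j)) (Measure.infinitePi μ) := by
  have hm : Measurable fun y : (∀ i, X i) × X j => Function.update y.1 j y.2 :=
    measurable_update'.comp measurable_id
  refine ⟨hm, Measure.eq_infinitePi μ fun s t ht => ?_⟩
  rw [Measure.map_apply hm (MeasurableSet.pi s.countable_toSet fun i _ => ht i)]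
  by_cases hj : j ∈ s
  · have : (fun y : (∀ i, X i) × X j => Function.update y.1 j y.2) ⁻¹' (Set.pi s t) =
        (Set.pi (s.erase j : Finset ι) t) ×ˢ t j := by
      ext y
      simp only [Set.mem_preimage, Set.mem_pi, Finset.mem_coe, Set.mem_prod, Finset.mem_erase]
      constructor
      · intro h
        refine ⟨fun i hi => ?_, ?_⟩
        · simpa [Function.update_of_ne hi.1] using h i hi.2
        · simpa using h j hj
      · rintro ⟨h1, h2⟩ i hi
        by_cases hij : i = j
        · subst hij; simpa using h2
        · simpa [Function.update_of_ne hij] using h1 i ⟨hij, hi⟩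
    rw [this, Measure.prod_prod, Measure.infinitePi_pi μ (fun i _ => ht i),
      Finset.prod_erase_mul _ _ hj]
  · have : (fun y : (∀ i, X i) × X j => Function.update y.1 j y.2) ⁻¹' (Set.pi s t) =
        (Set.pi s t) ×ˢ Set.univ := by
      ext y
      simp only [Set.mem_preimage, Set.mem_pi, Finset.mem_coe, Set.mem_prod, Set.mem_univ,
        and_true]
      refine forall₂_congr fun i hi => ?_
      rw [Function.update_of_ne (ne_of_mem_of_not_mem hi hj)]
    rw [this, Measure.prod_prod, Measure.infinitePi_pi μ (fun i _ => ht i), measure_univ, mul_one]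

theorem lintegral_infinitePi_update (j : ι) {f : (∀ i, X i) → ℝ≥0∞} (hf : Measurable f) :
    ∫⁻ ω, f ω ∂(Measure.infinitePi μ) =
      ∫⁻ ω, ∫⁻ x, f (Function.update ω j x) ∂(μ j) ∂(Measure.infinitePi μ) := by
  have h := measurePreserving_update_infinitePi μ j
  rw [← h.lintegral_comp hf]
  exact lintegral_prod _ (hf.comp h.measurable).aemeasurable

/-- A coordinate is independent of a function that does not depend on it. -/
theorem lintegral_infinitePi_mul_eval (j : ι) {F : (∀ i, X i) → ℝ≥0∞} {g : X j → ℝ≥0∞}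
    (hF : Measurable F) (hg : Measurable g) (hinv : ∀ ω x, F (Function.update ω j x) = F ω) :
    ∫⁻ ω, F ω * g (ω j) ∂(Measure.infinitePi μ) =
      (∫⁻ ω, F ω ∂(Measure.infinitePi μ)) * ∫⁻ x, g x ∂(μ j) := by
  have hm : Measurable fun ω : ∀ i, X i => F ω * g (ω j) :=
    hF.mul (hg.comp (measurable_pi_apply j))
  rw [lintegral_infinitePi_update μ j hm]
  simp only [hinv, Function.update_self]
  rw [← lintegral_mul_const _ hF]
  exact lintegral_congr fun ω => lintegral_const_mul _ hg

/-- The version of `lintegral_infinitePi_mul_eval` for a pair of product measures. -/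
theorem lintegral_infinitePi_prod_mul_eval {Y : ι → Type*} {mY : ∀ i, MeasurableSpace (Y i)}
    (ν : ∀ i, Measure (Y i)) [hν : ∀ i, IsProbabilityMeasure (ν i)] (j : ι)
    {F : (∀ i, X i) × (∀ i, Y i) → ℝ≥0∞} {g : X j × Y j → ℝ≥0∞}
    (hF : Measurable F) (hg : Measurable g)
    (hinv : ∀ ω x y, F (Function.update ω.1 j x, Function.update ω.2 j y) = F ω) :
    ∫⁻ ω, F ω * g (ω.1 j, ω.2 j) ∂((Measure.infinitePi μ).prod (Measure.infinitePi ν)) =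
      (∫⁻ ω, F ω ∂((Measure.infinitePi μ).prod (Measure.infinitePi ν))) *
        ∫⁻ x, g x ∂((μ j).prod (ν j)) := by
  have hev : Measurable fun ω : (∀ i, X i) × (∀ i, Y i) => (ω.1 j, ω.2 j) := by fun_prop
  have hm : Measurable fun ω : (∀ i, X i) × (∀ i, Y i) => F ω * g (ω.1 j, ω.2 j) :=
    hF.mul (hg.comp hev)
  rw [lintegral_prod _ hm.aemeasurable, lintegral_prod _ hF.aemeasurable,
    lintegral_prod _ hg.aemeasurable]
  have h1 : ∀ ω : ∀ i, X i,
      ∫⁻ ω', F (ω, ω') * g (ω j, ω' j) ∂(Measure.infinitePi ν) =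
        (∫⁻ ω', F (ω, ω') ∂(Measure.infinitePi ν)) * ∫⁻ y, g (ω j, y) ∂(ν j) := by
    intro ω
    refine lintegral_infinitePi_mul_eval ν j (F := fun ω' => F (ω, ω')) (g := fun y => g (ω j, y))
      (hF.comp measurable_prodMk_left) (hg.comp measurable_prodMk_left) fun ω' y => ?_
    simpa using hinv (ω, ω') (ω j) y
  simp only [h1]
  refine lintegral_infinitePi_mul_eval μ j (F := fun ω => ∫⁻ ω', F (ω, ω') ∂(Measure.infinitePi ν))
    (g := fun x => ∫⁻ y, g (x, y) ∂(ν j)) hF.lintegral_prod_right' hg.lintegral_prod_right'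
    fun ω x => ?_
  refine lintegral_congr fun ω' => ?_
  simpa using hinv (ω, ω') x (ω' j)

end Resampling

/-- If `B` contains at most one of the values of the coordinate `j`, whatever the other coordinates
are, then `B` contains at most half of every set that does not depend on `j`. -/
theorem infinitePi_inter_le_half {ι : Type*} [DecidableEq ι] (j : ι) {E B : Set (ι → ZMod 2)}
    (hE : MeasurableSet E) (hB : MeasurableSet B)
    (hinv : ∀ ω x, Function.update ω j x ∈ E ↔ ω ∈ E)
    (hone : ∀ ω ∈ E, ∀ x y, Function.update ω j x ∈ B → Function.update ω j y ∈ B → x = y) :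
    (Measure.infinitePi fun _ : ι => uniformOn (Set.univ : Set (ZMod 2))) (E ∩ B) ≤
      2⁻¹ * (Measure.infinitePi fun _ : ι => uniformOn (Set.univ : Set (ZMod 2))) E := by
  have : IsProbabilityMeasure (uniformOn (Set.univ : Set (ZMod 2))) :=
    isProbabilityMeasure_uniformOn Set.finite_univ Set.univ_nonempty
  rw [← lintegral_indicator_one (hE.inter hB), ← lintegral_indicator_one hE,
    lintegral_infinitePi_update _ j (measurable_one.indicator (hE.inter hB)),
    ← lintegral_const_mul _ (measurable_one.indicator hE)]
  refine lintegral_mono fun ω => ?_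
  by_cases hω : ω ∈ E
  · have hs : (fun x : ZMod 2 => (E ∩ B).indicator (1 : (ι → ZMod 2) → ℝ≥0∞)
        (Function.update ω j x)) = {x | Function.update ω j x ∈ B}.indicator 1 := by
      funext x
      have : Function.update ω j x ∈ E ∩ B ↔ x ∈ {x | Function.update ω j x ∈ B} :=
        ⟨fun h => h.2, fun h => ⟨(hinv ω x).2 hω, h⟩⟩
      by_cases hx : Function.update ω j x ∈ E ∩ B
      · rw [Set.indicator_of_mem hx, Set.indicator_of_mem (this.1 hx)]; rfl
      · rw [Set.indicator_of_notMem hx, Set.indicator_of_notMem (mt this.2 hx)]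
    have hsub : {x : ZMod 2 | Function.update ω j x ∈ B}.Subsingleton :=
      fun x hx y hy => hone ω hω x y hx hy
    simp only [hs, Set.indicator_of_mem hω, Pi.one_apply, mul_one]
    rw [lintegral_indicator_one (Set.toFinite _).measurableSet, uniformOn_univ]
    have hc : Measure.count {x : ZMod 2 | Function.update ω j x ∈ B} ≤ 1 := by
      rcases hsub.eq_empty_or_singleton with h | ⟨a, h⟩ <;> simp [h]
    simp only [ZMod.card]
    rw [ENNReal.div_eq_inv_mul]
    calc ((2 : ℕ) : ℝ≥0∞)⁻¹ * _ ≤ ((2 : ℕ) : ℝ≥0∞)⁻¹ * 1 := by gcongr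
      _ = 2⁻¹ := by simp
  · have : ∀ x, (E ∩ B).indicator (1 : (ι → ZMod 2) → ℝ≥0∞) (Function.update ω j x) = 0 := by
      intro x
      exact Set.indicator_of_notMem (fun h => hω ((hinv ω x).1 h.1)) _
    simp [this]

/-! ### Awareness of a vector and its frontier -/

section Awareness

variable {L q α : ℕ}

/-- The packet of transmission `t` over link `i` is received and pertains to chunk `b`. -/
def Received (ch : Fin L × ℕ → Fin q) (τ : Traffic L) (b : Fin q) (i t : ℕ) : Prop :=
  ∃ h : i < L, τ (⟨i, h⟩, t) = true ∧ ch (⟨i, h⟩, t) = b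

/-- The product of `x` with the global encoding vector of transmission `t` over link `i`. -/
noncomputable def pairing (c : ChunkedCode L q α) (τ : Traffic L) (x : Fin α → ZMod 2)
    (i t : ℕ) : ZMod 2 :=
  if h : i < L then x ⬝ᵥ encVec c τ i h t else 0

/-- Before transmission `t`, node `i` is the source or has received a packet of chunk `b` whose
global encoding vector is not orthogonal to `x`. -/
def Aware (c : ChunkedCode L q α) (τ : Traffic L) (b : Fin q) (x : Fin α → ZMod 2) :
    ℕ → ℕ → Prop
  | 0, _ => True
  | i + 1, t => ∃ s < t, Received c.chunk τ b i s ∧ pairing c τ x i s ≠ 0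

/-- Node `i` is aware of `x` and the next node is not. -/
def AwareFrontier (c : ChunkedCode L q α) (τ : Traffic L) (b : Fin q) (x : Fin α → ZMod 2)
    (i t : ℕ) : Prop :=
  Aware c τ b x i t ∧ ¬ Aware c τ b x (i + 1) t

theorem pairing_zero (c : ChunkedCode L q α) (τ : Traffic L) (x : Fin α → ZMod 2) (hL : 0 < L)
    (t : ℕ) : pairing c τ x 0 t = ∑ j, x j * c.src (t, j) := by
  simp [pairing, hL, encVec, dotProduct]

open Classical in
theorem pairing_succ (c : ChunkedCode L q α) (τ : Traffic L) (b : Fin q) (x : Fin α → ZMod 2)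
    {i : ℕ} (h : i + 1 < L) {t : ℕ} (hb : c.chunk (⟨i + 1, h⟩, t) = b) :
    pairing c τ x (i + 1) t = ∑ s ∈ Finset.range t,
      if Received c.chunk τ b i s then c.loc (⟨i + 1, h⟩, t, s) * pairing c τ x i s else 0 := by
  have hi : i < L := Nat.lt_of_succ_lt h
  simp only [pairing, h, hi, dif_pos, encVec, dotProduct_sum]
  refine Finset.sum_congr rfl fun s _ => ?_
  have : Received c.chunk τ b i s ↔ (τ (⟨i, hi⟩, s) = true ∧
      c.chunk (⟨i, hi⟩, s) = c.chunk (⟨i + 1, h⟩, t)) := by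
    simp [Received, hi, hb]
  by_cases hr : Received c.chunk τ b i s
  · rw [if_pos hr, if_pos (this.1 hr), dotProduct_smul, smul_eq_mul]
  · rw [if_neg hr, if_neg (fun h' => hr (this.2 h')), dotProduct_zero]

theorem aware_of_pairing_ne_zero {c : ChunkedCode L q α} {τ : Traffic L} {b : Fin q}
    {x : Fin α → ZMod 2} {i t : ℕ} (hr : Received c.chunk τ b i t)
    (hp : pairing c τ x i t ≠ 0) : Aware c τ b x i t := by
  classical
  cases i with
  | zero => trivial
  | succ i =>
    obtain ⟨h, -, hb⟩ := hr
    rw [pairing_succ c τ b x h hb] at hp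
    obtain ⟨s, hs, hne⟩ := Finset.exists_ne_zero_of_sum_ne_zero hp
    rw [Finset.mem_range] at hs
    by_cases hrs : Received c.chunk τ b i s
    · rw [if_pos hrs] at hne
      exact ⟨s, hs, hrs, right_ne_zero_of_mul hne⟩
    · simp [hrs] at hne

theorem Aware.succ_time {c : ChunkedCode L q α} {τ : Traffic L} {b : Fin q}
    {x : Fin α → ZMod 2} {i t : ℕ} (h : Aware c τ b x i t) : Aware c τ b x i (t + 1) := by
  cases i with
  | zero => trivial
  | succ i =>
    obtain ⟨s, hs, h⟩ := h
    exact ⟨s, hs.trans (Nat.lt_succ_self t), h⟩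

/-- Awareness crosses at most one link per time step: a packet that makes a node newly aware comes
from a node that was already aware, because a combination of packets orthogonal to x is orthogonal
to x. -/
theorem AwareFrontier.of_succ_time {c : ChunkedCode L q α} {τ : Traffic L} {b : Fin q}
    {x : Fin α → ZMod 2} {i t : ℕ} (h : AwareFrontier c τ b x i (t + 1)) :
    (AwareFrontier c τ b x i t ∧ (Received c.chunk τ b i t → pairing c τ x i t = 0)) ∨
      ∃ j, i = j + 1 ∧ AwareFrontier c τ b x j t ∧ Received c.chunk τ b j t ∧
        pairing c τ x j t ≠ 0 := by
  obtain ⟨h1, h2⟩ := h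
  have h2' : ¬ Aware c τ b x (i + 1) t := fun h => h2 h.succ_time
  by_cases ha : Aware c τ b x i t
  · refine Or.inl ⟨⟨ha, h2'⟩, fun hr => ?_⟩
    by_contra hp
    exact h2 ⟨t, Nat.lt_succ_self t, hr, hp⟩
  · cases i with
    | zero => exact absurd trivial ha
    | succ j =>
      obtain ⟨s, hs, hr, hp⟩ := h1
      have hst : s = t := by
        by_contra hne
        exact ha ⟨s, by omega, hr, hp⟩
      subst hst
      exact Or.inr ⟨j, rfl, ⟨aware_of_pairing_ne_zero hr hp, ha⟩, hr, hp⟩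

/-- The source is always aware, so awareness breaks off somewhere before node `n`. -/
theorem exists_frontier_of_not_aware {c : ChunkedCode L q α} {τ : Traffic L} {b : Fin q}
    {x : Fin α → ZMod 2} {n t : ℕ} (h : ¬ Aware c τ b x n t) :
    ∃ i < n, AwareFrontier c τ b x i t := by
  induction n with
  | zero => exact absurd trivial h
  | succ n ih =>
    by_cases hn : Aware c τ b x n t
    · exact ⟨n, Nat.lt_succ_self n, hn, h⟩
    · obtain ⟨i, hi, hf⟩ := ih hn
      exact ⟨i, hi.trans (Nat.lt_succ_self n), hf⟩

/-- If the sink is aware of every nonzero vector in every chunk, it can decode. -/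
theorem decodedBy_of_aware {c : ChunkedCode L q α} {τ : Traffic L} {N : ℕ} (hL : 0 < L)
    (h : ∀ b, ∀ x : Fin α → ZMod 2, x ≠ 0 → Aware c τ b x L N) : DecodedBy c τ N := by
  intro b
  suffices hs : sinkSpan c τ b N = ⊤ by
    rw [hs, finrank_top, Module.finrank_fin_fun]
  -- A proper subspace lies in the kernel of a nonzero functional, which is the product with some `x
  -- ≠ 0`; awareness of this `x` provides a vector of the span outside the kernel.
  by_contra hne
  obtain ⟨f, hf, hle⟩ := Submodule.exists_le_ker_of_lt_top _ (lt_top_iff_ne_top.2 hne)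
  set x : Fin α → ZMod 2 := fun j => f (Pi.single j 1) with hx
  have hfx : ∀ v, f v = x ⬝ᵥ v := by
    intro v
    rw [LinearMap.pi_apply_eq_sum_univ f v, dotProduct]
    refine Finset.sum_congr rfl fun j _ => ?_
    have : (fun i => if j = i then (1 : ZMod 2) else 0) = Pi.single j 1 := by
      funext i; simp [Pi.single_apply, eq_comm]
    simp [hx, this, mul_comm]
  have hx0 : x ≠ 0 := by
    intro h0
    exact hf (LinearMap.ext fun v => by simp [hfx, h0])
  obtain ⟨n, rfl⟩ : ∃ n, L = n + 1 := ⟨L - 1, by omega⟩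
  obtain ⟨s, hs, ⟨hn, hτ, hb⟩, hp⟩ := h b x hx0
  apply hp
  have hmem : encVec c τ n hn s ∈ sinkSpan c τ b N :=
    Submodule.subset_span ⟨⟨n, hn⟩, rfl, s, hs, hτ, hb, rfl⟩
  have := hle hmem
  rw [LinearMap.mem_ker, hfx] at this
  simp [pairing, hn, this]

end Awareness

/-! ### Measurability in the code and the traffic -/

section Measurability

variable {L q α : ℕ}

theorem measurable_encVec (i : ℕ) (h : i < L) (t : ℕ) :
    Measurable fun y : ((Fin L × ℕ → Fin q) × (ℕ × Fin α → ZMod 2) × (Fin L × ℕ × ℕ → ZMod 2)) ×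
      Traffic L => encVec (ChunkedCode.ofTriple y.1) y.2 i h t := by
  induction i generalizing t with
  | zero =>
    simp only [encVec, ChunkedCode.ofTriple]
    fun_prop
  | succ i ih =>
    simp only [encVec]
    refine Finset.measurable_sum _ fun s _ => Measurable.ite ?_ ?_ measurable_const
    · refine MeasurableSet.inter ?_ ?_
      · exact measurableSet_eq_fun (by fun_prop) measurable_const
      · simp only [ChunkedCode.ofTriple]
        exact measurableSet_eq_fun (by fun_prop) (by fun_prop)
    · refine measurable_pi_lambda _ fun j => ?_
      simp only [Pi.smul_apply, smul_eq_mul]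
      have hloc : Measurable fun y : ((Fin L × ℕ → Fin q) × (ℕ × Fin α → ZMod 2) ×
          (Fin L × ℕ × ℕ → ZMod 2)) × Traffic L =>
            (ChunkedCode.ofTriple y.1).loc (⟨i + 1, h⟩, t, s) := by
        simp only [ChunkedCode.ofTriple]
        fun_prop
      exact (measurable_of_finite fun v : ZMod 2 × ZMod 2 => v.1 * v.2).comp
        (hloc.prodMk ((measurable_pi_apply j).comp (ih (Nat.lt_of_succ_lt h) s)))

theorem measurable_pairing (x : Fin α → ZMod 2) (i t : ℕ) :
    Measurable fun y : ((Fin L × ℕ → Fin q) × (ℕ × Fin α → ZMod 2) × (Fin L × ℕ × ℕ → ZMod 2)) ×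
      Traffic L => pairing (ChunkedCode.ofTriple y.1) y.2 x i t := by
  unfold pairing
  by_cases h : i < L
  · simp only [h, dif_pos]
    exact (measurable_of_finite fun v : Fin α → ZMod 2 => x ⬝ᵥ v).comp (measurable_encVec i h t)
  · simp only [h, dif_neg, not_false_eq_true]
    exact measurable_const

theorem measurableSet_received (b : Fin q) (i t : ℕ) :
    MeasurableSet {y : (Fin L × ℕ → Fin q) × Traffic L | Received y.1 y.2 b i t} := by
  unfold Received
  by_cases h : i < L
  · simp only [h, exists_true_left]
    exact (measurableSet_eq_fun (by fun_prop) measurable_const).inter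
      (measurableSet_eq_fun (by fun_prop) measurable_const)
  · simp [h]

theorem measurableSet_aware (b : Fin q) (x : Fin α → ZMod 2) (i t : ℕ) :
    MeasurableSet {y : ((Fin L × ℕ → Fin q) × (ℕ × Fin α → ZMod 2) ×
      (Fin L × ℕ × ℕ → ZMod 2)) × Traffic L |
        Aware (ChunkedCode.ofTriple y.1) y.2 b x i t} := by
  cases i with
  | zero => simp [Aware]
  | succ i =>
    have : {y : ((Fin L × ℕ → Fin q) × (ℕ × Fin α → ZMod 2) ×
        (Fin L × ℕ × ℕ → ZMod 2)) × Traffic L |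
          Aware (ChunkedCode.ofTriple y.1) y.2 b x (i + 1) t} =
        ⋃ s ∈ Finset.range t, ({y | Received y.1.1 y.2 b i s} ∩
          {y | pairing (ChunkedCode.ofTriple y.1) y.2 x i s ≠ 0}) := by
      ext y
      simp only [Aware, ChunkedCode.ofTriple, Set.mem_ofPred_eq, Set.mem_iUnion, Finset.mem_range,
        Set.mem_inter_iff, exists_prop]
    rw [this]
    refine Finset.measurableSet_biUnion _ fun s _ => MeasurableSet.inter ?_ ?_
    · exact (measurable_fst.fst.prodMk measurable_snd) (measurableSet_received b i s)
    · exact (measurableSet_eq_fun (measurable_pairing x i s) measurable_const).compl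

theorem measurableSet_awareFrontier (b : Fin q) (x : Fin α → ZMod 2) (i t : ℕ) :
    MeasurableSet {y : ((Fin L × ℕ → Fin q) × (ℕ × Fin α → ZMod 2) ×
      (Fin L × ℕ × ℕ → ZMod 2)) × Traffic L |
        AwareFrontier (ChunkedCode.ofTriple y.1) y.2 b x i t} :=
  (measurableSet_aware b x i t).inter (measurableSet_aware b x (i + 1) t).compl

end Measurability

/-! ### A fresh coefficient halves the probability -/

section FreshBit

variable {L q α : ℕ}

/-- The law of the coefficients of a random chunked code. -/
noncomputable def coefLaw (L α : ℕ) :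
    Measure ((ℕ × Fin α → ZMod 2) × (Fin L × ℕ × ℕ → ZMod 2)) :=
  (Measure.infinitePi fun _ : ℕ × Fin α => uniformOn (Set.univ : Set (ZMod 2))).prod
    (Measure.infinitePi fun _ : Fin L × ℕ × ℕ => uniformOn (Set.univ : Set (ZMod 2)))

instance : IsProbabilityMeasure (uniformOn (Set.univ : Set (ZMod 2))) :=
  isProbabilityMeasure_uniformOn Set.finite_univ Set.univ_nonempty

instance : IsProbabilityMeasure (coefLaw L α) := by
  unfold coefLaw
  infer_instance

/-- The two families of coefficients coincide for all transmissions before `t`. -/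
def AgreeBefore (t : ℕ) (ω ω' : (ℕ × Fin α → ZMod 2) × (Fin L × ℕ × ℕ → ZMod 2)) : Prop :=
  (∀ s < t, ∀ j, ω.1 (s, j) = ω'.1 (s, j)) ∧ ∀ i, ∀ s < t, ∀ s', ω.2 (i, s, s') = ω'.2 (i, s, s')

theorem AgreeBefore.encVec_eq {t : ℕ}
    {ω ω' : (ℕ × Fin α → ZMod 2) × (Fin L × ℕ × ℕ → ZMod 2)} (h : AgreeBefore t ω ω')
    (ch : Fin L × ℕ → Fin q) (τ : Traffic L) (i : ℕ) (hi : i < L) {s : ℕ} (hs : s < t) :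
    encVec ⟨ch, ω.1, ω.2⟩ τ i hi s = encVec ⟨ch, ω'.1, ω'.2⟩ τ i hi s := by
  induction i generalizing s with
  | zero => funext j; exact h.1 s hs j
  | succ i ih =>
    simp only [encVec]
    refine Finset.sum_congr rfl fun s' hs' => ?_
    rw [ih (Nat.lt_of_succ_lt hi) ((Finset.mem_range.1 hs').trans hs), h.2 _ s hs s']

theorem AgreeBefore.pairing_eq {t : ℕ}
    {ω ω' : (ℕ × Fin α → ZMod 2) × (Fin L × ℕ × ℕ → ZMod 2)} (h : AgreeBefore t ω ω')
    (ch : Fin L × ℕ → Fin q) (τ : Traffic L) (x : Fin α → ZMod 2) (i : ℕ) {s : ℕ} (hs : s < t) :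
    pairing ⟨ch, ω.1, ω.2⟩ τ x i s = pairing ⟨ch, ω'.1, ω'.2⟩ τ x i s := by
  unfold pairing
  split_ifs with hi
  · rw [h.encVec_eq ch τ i hi hs]
  · rfl

theorem AgreeBefore.aware_iff {t : ℕ}
    {ω ω' : (ℕ × Fin α → ZMod 2) × (Fin L × ℕ × ℕ → ZMod 2)} (h : AgreeBefore t ω ω')
    (ch : Fin L × ℕ → Fin q) (τ : Traffic L) (b : Fin q) (x : Fin α → ZMod 2) (i : ℕ) :
    Aware ⟨ch, ω.1, ω.2⟩ τ b x i t ↔ Aware ⟨ch, ω'.1, ω'.2⟩ τ b x i t := by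
  cases i with
  | zero => rfl
  | succ i =>
    simp only [Aware]
    refine exists_congr fun s => and_congr_right fun hs => ?_
    rw [h.pairing_eq ch τ x i hs]

theorem AgreeBefore.awareFrontier_iff {t : ℕ}
    {ω ω' : (ℕ × Fin α → ZMod 2) × (Fin L × ℕ × ℕ → ZMod 2)} (h : AgreeBefore t ω ω')
    (ch : Fin L × ℕ → Fin q) (τ : Traffic L) (b : Fin q) (x : Fin α → ZMod 2) (i : ℕ) :
    AwareFrontier ⟨ch, ω.1, ω.2⟩ τ b x i t ↔ AwareFrontier ⟨ch, ω'.1, ω'.2⟩ τ b x i t := by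
  simp only [AwareFrontier, h.aware_iff ch τ b x]

theorem agreeBefore_update_src (ω : (ℕ × Fin α → ZMod 2) × (Fin L × ℕ × ℕ → ZMod 2)) (t : ℕ)
    (j : Fin α) (u : ZMod 2) : AgreeBefore t (Function.update ω.1 (t, j) u, ω.2) ω := by
  refine ⟨fun s hs j' => ?_, fun _ _ _ _ => rfl⟩
  exact Function.update_of_ne (fun h => hs.ne (Prod.ext_iff.1 h).1) _ _

theorem agreeBefore_update_loc (ω : (ℕ × Fin α → ZMod 2) × (Fin L × ℕ × ℕ → ZMod 2)) (t : ℕ)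
    (i : Fin L) (s : ℕ) (u : ZMod 2) :
    AgreeBefore t (ω.1, Function.update ω.2 (i, t, s) u) ω := by
  refine ⟨fun _ _ _ => rfl, fun i' s' hs' s'' => ?_⟩
  exact Function.update_of_ne
    (fun h => hs'.ne (Prod.ext_iff.1 (Prod.ext_iff.1 h).2).1) _ _

theorem measurable_pairing_coef (ch : Fin L × ℕ → Fin q) (τ : Traffic L) (x : Fin α → ZMod 2)
    (i t : ℕ) : Measurable fun ω : (ℕ × Fin α → ZMod 2) × (Fin L × ℕ × ℕ → ZMod 2) =>
      pairing ⟨ch, ω.1, ω.2⟩ τ x i t :=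
  (measurable_pairing (q := q) x i t).comp
    (f := fun ω : (ℕ × Fin α → ZMod 2) × (Fin L × ℕ × ℕ → ZMod 2) => ((ch, ω), τ)) (by fun_prop)

theorem measurableSet_awareFrontier_coef (ch : Fin L × ℕ → Fin q) (τ : Traffic L) (b : Fin q)
    (x : Fin α → ZMod 2) (i t : ℕ) :
    MeasurableSet {ω : (ℕ × Fin α → ZMod 2) × (Fin L × ℕ × ℕ → ZMod 2) |
      AwareFrontier ⟨ch, ω.1, ω.2⟩ τ b x i t} :=
  (show Measurable fun ω : (ℕ × Fin α → ZMod 2) × (Fin L × ℕ × ℕ → ZMod 2) => ((ch, ω), τ) by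
    fun_prop) (measurableSet_awareFrontier b x i t)

theorem coefLaw_inter_le_half_src (t : ℕ) (j : Fin α)
    {E B : Set ((ℕ × Fin α → ZMod 2) × (Fin L × ℕ × ℕ → ZMod 2))}
    (hE : MeasurableSet E) (hB : MeasurableSet B)
    (hinv : ∀ ω ω', AgreeBefore t ω ω' → (ω ∈ E ↔ ω' ∈ E))
    (hone : ∀ ω ∈ E, ∀ u v, (Function.update ω.1 (t, j) u, ω.2) ∈ B →
      (Function.update ω.1 (t, j) v, ω.2) ∈ B → u = v) :
    coefLaw L α (E ∩ B) ≤ 2⁻¹ * coefLaw L α E := by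
  unfold coefLaw
  rw [Measure.prod_apply_symm (hE.inter hB), Measure.prod_apply_symm hE,
    ← lintegral_const_mul _ (measurable_measure_prodMk_right hE)]
  refine lintegral_mono fun ω₂ => ?_
  exact infinitePi_inter_le_half (t, j) (measurable_prodMk_right hE) (measurable_prodMk_right hB)
    (fun ω₁ u => hinv _ _ (agreeBefore_update_src (ω₁, ω₂) t j u))
    (fun ω₁ h u v => hone (ω₁, ω₂) h u v)

theorem coefLaw_inter_le_half_loc (i : Fin L) (t s : ℕ)
    {E B : Set ((ℕ × Fin α → ZMod 2) × (Fin L × ℕ × ℕ → ZMod 2))}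
    (hE : MeasurableSet E) (hB : MeasurableSet B)
    (hinv : ∀ ω ω', AgreeBefore t ω ω' → (ω ∈ E ↔ ω' ∈ E))
    (hone : ∀ ω ∈ E, ∀ u v, (ω.1, Function.update ω.2 (i, t, s) u) ∈ B →
      (ω.1, Function.update ω.2 (i, t, s) v) ∈ B → u = v) :
    coefLaw L α (E ∩ B) ≤ 2⁻¹ * coefLaw L α E := by
  unfold coefLaw
  rw [Measure.prod_apply (hE.inter hB), Measure.prod_apply hE,
    ← lintegral_const_mul _ (measurable_measure_prodMk_left hE)]
  refine lintegral_mono fun ω₁ => ?_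
  exact infinitePi_inter_le_half (i, t, s) (measurable_prodMk_left hE) (measurable_prodMk_left hB)
    (fun ω₂ u => hinv _ _ (agreeBefore_update_loc (ω₁, ω₂) t i s u))
    (fun ω₂ h u v => hone (ω₁, ω₂) h u v)

/-- The fresh bit is the source coefficient of a message vector `j` with `x j ≠ 0`: once the others
are fixed, it determines the pairing injectively. -/
theorem coefLaw_pairing_zero_le_half (ch : Fin L × ℕ → Fin q) (τ : Traffic L)
    {x : Fin α → ZMod 2} (hx : x ≠ 0) (hL : 0 < L) (t : ℕ) (v : ZMod 2)
    {E : Set ((ℕ × Fin α → ZMod 2) × (Fin L × ℕ × ℕ → ZMod 2))} (hE : MeasurableSet E)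
    (hinv : ∀ ω ω', AgreeBefore t ω ω' → (ω ∈ E ↔ ω' ∈ E)) :
    coefLaw L α (E ∩ {ω | pairing ⟨ch, ω.1, ω.2⟩ τ x 0 t = v}) ≤ 2⁻¹ * coefLaw L α E := by
  obtain ⟨j, hj⟩ : ∃ j, x j ≠ 0 := Function.ne_iff.1 hx
  refine coefLaw_inter_le_half_src t j hE
    (measurableSet_eq_fun (measurable_pairing_coef ch τ x 0 t) measurable_const) hinv ?_
  intro ω _ u u' hu hu'
  simp only [Set.mem_ofPred_eq, pairing_zero _ _ _ hL] at hu hu'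
  rw [← Finset.add_sum_erase _ _ (Finset.mem_univ j)] at hu hu'
  have hrest : ∀ u, ∑ i ∈ Finset.univ.erase j, x i * Function.update ω.1 (t, j) u (t, i) =
      ∑ i ∈ Finset.univ.erase j, x i * ω.1 (t, i) := by
    intro u
    refine Finset.sum_congr rfl fun i hi => ?_
    rw [Function.update_of_ne fun h => Finset.ne_of_mem_erase hi (Prod.ext_iff.1 h).2]
  rw [hrest, Function.update_self] at hu hu'
  exact mul_left_cancel₀ hj (add_right_cancel (hu.trans hu'.symm))

/-- The fresh bit is the local coefficient of a received packet `s` not orthogonal to `x`. Which `s`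
qualifies depends on the past, so `E` is split by induction on a set `F` of candidates: on the part
where `s` qualifies its coefficient is resampled, and elsewhere the remaining candidates suffice. -/
theorem coefLaw_pairing_succ_le_half (ch : Fin L × ℕ → Fin q) (τ : Traffic L) (b : Fin q)
    (x : Fin α → ZMod 2) {i : ℕ} (h : i + 1 < L) {t : ℕ} (hb : ch (⟨i + 1, h⟩, t) = b)
    (v : ZMod 2) (F : Finset ℕ) (hF : F ⊆ Finset.range t)
    {E : Set ((ℕ × Fin α → ZMod 2) × (Fin L × ℕ × ℕ → ZMod 2))} (hE : MeasurableSet E)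
    (hinv : ∀ ω ω', AgreeBefore t ω ω' → (ω ∈ E ↔ ω' ∈ E))
    (hcov : ∀ ω ∈ E, ∃ s ∈ F, Received ch τ b i s ∧ pairing ⟨ch, ω.1, ω.2⟩ τ x i s ≠ 0) :
    coefLaw L α (E ∩ {ω | pairing ⟨ch, ω.1, ω.2⟩ τ x (i + 1) t = v}) ≤
      2⁻¹ * coefLaw L α E := by
  classical
  induction F using Finset.induction_on generalizing E with
  | empty =>
    have : E = ∅ := Set.eq_empty_of_forall_notMem fun ω hω => by simpa using hcov ω hω
    simp [this]
  | insert s F hs ih =>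
    rw [Finset.insert_subset_iff, Finset.mem_range] at hF
    set B : Set ((ℕ × Fin α → ZMod 2) × (Fin L × ℕ × ℕ → ZMod 2)) :=
      {ω | pairing ⟨ch, ω.1, ω.2⟩ τ x (i + 1) t = v} with hBdef
    set H : Set ((ℕ × Fin α → ZMod 2) × (Fin L × ℕ × ℕ → ZMod 2)) :=
      {ω | Received ch τ b i s ∧ pairing ⟨ch, ω.1, ω.2⟩ τ x i s ≠ 0} with hHdef
    have hB : MeasurableSet B :=
      measurableSet_eq_fun (measurable_pairing_coef ch τ x (i + 1) t) measurable_const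
    have hH : MeasurableSet H := (MeasurableSet.const _).inter
      (measurableSet_eq_fun (measurable_pairing_coef ch τ x i s) measurable_const).compl
    have hHinv : ∀ ω ω', AgreeBefore t ω ω' → (ω ∈ H ↔ ω' ∈ H) := by
      intro ω ω' hω
      simp only [hHdef, Set.mem_ofPred_eq, hω.pairing_eq ch τ x i hF.1]
    have h1 : coefLaw L α ((E ∩ H) ∩ B) ≤ 2⁻¹ * coefLaw L α (E ∩ H) := by
      refine coefLaw_inter_le_half_loc ⟨i + 1, h⟩ t s (hE.inter hH) hB
        (fun ω ω' hω => and_congr (hinv ω ω' hω) (hHinv ω ω' hω)) ?_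
      rintro ω ⟨-, hr, hp⟩ u u' hu hu'
      simp only [hBdef, Set.mem_ofPred_eq] at hu hu'
      rw [pairing_succ _ _ _ _ h hb, ← Finset.add_sum_erase _ _ (Finset.mem_range.2 hF.1)]
        at hu hu'
      have hpair : ∀ u i' s', s' < t →
          pairing ⟨ch, ω.1, Function.update ω.2 (⟨i + 1, h⟩, t, s) u⟩ τ x i' s' =
            pairing ⟨ch, ω.1, ω.2⟩ τ x i' s' := fun u i' s' hs' =>
        (agreeBefore_update_loc ω t ⟨i + 1, h⟩ s u).pairing_eq ch τ x i' hs'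
      have hrest : ∀ u, (∑ s' ∈ (Finset.range t).erase s, if Received ch τ b i s' then
          Function.update ω.2 (⟨i + 1, h⟩, t, s) u (⟨i + 1, h⟩, t, s') *
            pairing ⟨ch, ω.1, Function.update ω.2 (⟨i + 1, h⟩, t, s) u⟩ τ x i s' else 0) =
          ∑ s' ∈ (Finset.range t).erase s, if Received ch τ b i s' then
            ω.2 (⟨i + 1, h⟩, t, s') * pairing ⟨ch, ω.1, ω.2⟩ τ x i s' else 0 := by
        intro u
        refine Finset.sum_congr rfl fun s' hs' => ?_
        rw [hpair u i s' (Finset.mem_range.1 (Finset.mem_of_mem_erase hs')),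
          Function.update_of_ne fun h' => Finset.ne_of_mem_erase hs'
            (Prod.ext_iff.1 (Prod.ext_iff.1 h').2).2]
      rw [hrest, if_pos hr, hpair _ _ _ hF.1] at hu hu'
      simp only [Function.update_self] at hu hu'
      exact mul_right_cancel₀ hp (add_right_cancel (hu.trans hu'.symm))
    have h2 : coefLaw L α ((E \ H) ∩ B) ≤ 2⁻¹ * coefLaw L α (E \ H) := by
      refine ih hF.2 (hE.diff hH)
        (fun ω ω' hω => and_congr (hinv ω ω' hω) (not_congr (hHinv ω ω' hω))) ?_
      rintro ω ⟨hω, hωH⟩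
      obtain ⟨s', hs', hrs⟩ := hcov ω hω
      rcases Finset.mem_insert.1 hs' with rfl | hs'
      · exact absurd hrs hωH
      · exact ⟨s', hs', hrs⟩
    have hsplit : E ∩ B = (E ∩ H) ∩ B ∪ (E \ H) ∩ B := by
      rw [← Set.union_inter_distrib_right, Set.inter_union_sdiff]
    calc coefLaw L α (E ∩ B) ≤ coefLaw L α ((E ∩ H) ∩ B) + coefLaw L α ((E \ H) ∩ B) := by
          rw [hsplit]; exact measure_union_le _ _
      _ ≤ 2⁻¹ * coefLaw L α (E ∩ H) + 2⁻¹ * coefLaw L α (E \ H) := add_le_add h1 h2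
      _ = 2⁻¹ * coefLaw L α E := by rw [← mul_add, measure_inter_add_sdiff E hH]

/-- Given the past, a packet sent by an aware node is orthogonal to `x` with probability `1 / 2`. -/
theorem coefLaw_awareFrontier_inter_pairing_le_half (ch : Fin L × ℕ → Fin q) (τ : Traffic L)
    (b : Fin q) {x : Fin α → ZMod 2} (hx : x ≠ 0) {i t : ℕ} (hr : Received ch τ b i t)
    (v : ZMod 2) :
    coefLaw L α ({ω | AwareFrontier ⟨ch, ω.1, ω.2⟩ τ b x i t} ∩
        {ω | pairing ⟨ch, ω.1, ω.2⟩ τ x i t = v}) ≤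
      2⁻¹ * coefLaw L α {ω | AwareFrontier ⟨ch, ω.1, ω.2⟩ τ b x i t} := by
  have hm := measurableSet_awareFrontier_coef (α := α) ch τ b x i t
  obtain ⟨hi, -, hb⟩ := hr
  cases i with
  | zero =>
    exact coefLaw_pairing_zero_le_half ch τ hx hi t v hm
      (fun ω ω' h => h.awareFrontier_iff ch τ b x 0)
  | succ i =>
    refine coefLaw_pairing_succ_le_half ch τ b x hi hb v (Finset.range t) subset_rfl hm
      (fun ω ω' h => h.awareFrontier_iff ch τ b x (i + 1)) ?_
    rintro ω ⟨⟨s, hs, h⟩, -⟩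
    exact ⟨s, Finset.mem_range.2 hs, h⟩

end FreshBit

/-! ### Path weights bound the frontier -/

section PathWeight

open Classical in
/-- The total weight of the directed paths from node `0` at time `0` to node `i` at time `t`, where
every transmission `R` that a path meets gives a factor `θ`, and where the path may follow it to the
next node. -/
noncomputable def pathWeight (θ : ℝ≥0∞) (R : ℕ → ℕ → Prop) : ℕ → ℕ → ℝ≥0∞
  | 0, 0 => 1
  | 0, _ + 1 => 0
  | t + 1, 0 => (if R 0 t then θ else 1) * pathWeight θ R t 0
  | t + 1, i + 1 => (if R (i + 1) t then θ else 1) * pathWeight θ R t (i + 1) +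
      (if R i t then θ else 0) * pathWeight θ R t i

/-- A single path has weight a power of `θ`, and `u ↦ u ^ η` is subadditive for `η ≤ 1`. -/
theorem pathWeight_rpow_le {η : ℝ} (h0 : 0 < η) (h1 : η ≤ 1) (θ : ℝ≥0∞) (R : ℕ → ℕ → Prop)
    (t i : ℕ) : pathWeight θ R t i ^ η ≤ pathWeight (θ ^ η) R t i := by
  classical
  induction t generalizing i with
  | zero => cases i <;> simp [pathWeight, h0]
  | succ t ih =>
    have e1 : ∀ j, (if R j t then θ else 1) ^ η = if R j t then θ ^ η else 1 := by
      intro j; split_ifs <;> simp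
    have e0 : ∀ j, (if R j t then θ else 0) ^ η = if R j t then θ ^ η else 0 := by
      intro j; split_ifs <;> simp [h0]
    cases i with
    | zero =>
      simp only [pathWeight]
      rw [ENNReal.mul_rpow_of_nonneg _ _ h0.le, e1]
      gcongr
      exact ih 0
    | succ i =>
      simp only [pathWeight]
      refine (ENNReal.rpow_add_le_add_rpow _ _ h0.le h1).trans ?_
      rw [ENNReal.mul_rpow_of_nonneg _ _ h0.le, ENNReal.mul_rpow_of_nonneg _ _ h0.le, e1, e0]
      gcongr
      · exact ih (i + 1)
      · exact ih i

theorem sum_rpow_le_sum_rpow {ι : Type*} {η : ℝ} (h0 : 0 < η) (h1 : η ≤ 1) (s : Finset ι)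
    (f : ι → ℝ≥0∞) : (∑ i ∈ s, f i) ^ η ≤ ∑ i ∈ s, f i ^ η := by
  classical
  induction s using Finset.induction_on with
  | empty => simp [h0]
  | insert a s ha ih =>
    rw [Finset.sum_insert ha, Finset.sum_insert ha]
    exact (ENNReal.rpow_add_le_add_rpow _ _ h0.le h1).trans (by gcongr)

variable {L q α : ℕ}

/-- Both ways of reaching the frontier at time `t + 1` are governed by the fresh bit: value 0 of the
pairing for staying, value 1 for moving. Each costs 1/2 when a packet is received; otherwise only
staying is possible. -/
theorem coefLaw_awareFrontier_le (ch : Fin L × ℕ → Fin q) (τ : Traffic L)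
    (b : Fin q) {x : Fin α → ZMod 2} (hx : x ≠ 0) (t i : ℕ) :
    coefLaw L α {ω | AwareFrontier ⟨ch, ω.1, ω.2⟩ τ b x i t} ≤
      pathWeight 2⁻¹ (Received ch τ b) t i := by
  classical
  induction t generalizing i with
  | zero =>
    cases i with
    | zero => exact prob_le_one
    | succ i => simp [AwareFrontier, Aware]
  | succ t ih =>
    have stay : coefLaw L α ({ω | AwareFrontier ⟨ch, ω.1, ω.2⟩ τ b x i t} ∩
        {ω | Received ch τ b i t → pairing ⟨ch, ω.1, ω.2⟩ τ x i t = 0}) ≤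
        (if Received ch τ b i t then 2⁻¹ else 1) * pathWeight 2⁻¹ (Received ch τ b) t i := by
      by_cases hr : Received ch τ b i t
      · simp only [hr, forall_const, if_true]
        exact (coefLaw_awareFrontier_inter_pairing_le_half ch τ b hx hr 0).trans
          (by gcongr; exact ih i)
      · simp only [hr, false_imp_iff, if_false, one_mul, Set.ofPred_true, Set.inter_univ]
        exact ih i
    cases i with
    | zero =>
      refine (measure_mono fun ω hω => ?_).trans stay
      rcases AwareFrontier.of_succ_time hω with h | ⟨j, hj, -⟩
      · exact h
      · exact absurd hj (Nat.succ_ne_zero j).symm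
    | succ i =>
      have move : coefLaw L α ({ω | AwareFrontier ⟨ch, ω.1, ω.2⟩ τ b x i t} ∩
          {ω | Received ch τ b i t ∧ pairing ⟨ch, ω.1, ω.2⟩ τ x i t = 1}) ≤
          (if Received ch τ b i t then 2⁻¹ else 0) * pathWeight 2⁻¹ (Received ch τ b) t i := by
        by_cases hr : Received ch τ b i t
        · simp only [hr, true_and, if_true]
          exact (coefLaw_awareFrontier_inter_pairing_le_half ch τ b hx hr 1).trans
            (by gcongr; exact ih i)
        · simp [hr]
      refine (measure_mono fun ω hω => ?_).trans ((measure_union_le _ _).trans (add_le_add stay move))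
      rcases AwareFrontier.of_succ_time hω with h | ⟨j, hj, h, hr, hp⟩
      · exact Or.inl h
      · obtain rfl : i = j := Nat.succ_injective hj
        have h01 : ∀ u : ZMod 2, u ≠ 0 → u = 1 := by decide
        exact Or.inr ⟨h, hr, h01 _ hp⟩

/-- Given the chunks and the traffic, some chunk cannot be decoded with at most this probability. -/
theorem coefLaw_exists_not_aware_le (ch : Fin L × ℕ → Fin q) (τ : Traffic L)
    (b : Fin q) (N : ℕ) {η : ℝ} (h0 : 0 < η) (h1 : η ≤ 1) :
    coefLaw L α {ω | ∃ x : Fin α → ZMod 2, x ≠ 0 ∧ ¬ Aware ⟨ch, ω.1, ω.2⟩ τ b x L N} ≤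
      (2 ^ η) ^ α * ∑ i ∈ Finset.range L, pathWeight (2⁻¹ ^ η) (Received ch τ b) N i := by
  classical
  set P := coefLaw L α {ω | ∃ x : Fin α → ZMod 2, x ≠ 0 ∧ ¬ Aware ⟨ch, ω.1, ω.2⟩ τ b x L N}
  have hP : P ≤ 2 ^ α * ∑ i ∈ Finset.range L, pathWeight 2⁻¹ (Received ch τ b) N i := by
    calc P ≤ coefLaw L α (⋃ x ∈ Finset.univ.filter (fun x : Fin α → ZMod 2 => x ≠ 0),
            ⋃ i ∈ Finset.range L, {ω | AwareFrontier ⟨ch, ω.1, ω.2⟩ τ b x i N}) := by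
          refine measure_mono ?_
          rintro ω ⟨x, hx, hω⟩
          obtain ⟨i, hi, hf⟩ := exists_frontier_of_not_aware hω
          simp only [Set.mem_iUnion, Finset.mem_filter, Finset.mem_univ, true_and,
            Finset.mem_range]
          exact ⟨x, hx, i, hi, hf⟩
      _ ≤ ∑ x ∈ Finset.univ.filter (fun x : Fin α → ZMod 2 => x ≠ 0),
            ∑ i ∈ Finset.range L, pathWeight 2⁻¹ (Received ch τ b) N i := by
          refine (measure_biUnion_finset_le _ _).trans (Finset.sum_le_sum fun x hx => ?_)
          refine (measure_biUnion_finset_le _ _).trans (Finset.sum_le_sum fun i _ => ?_)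
          exact coefLaw_awareFrontier_le ch τ b (Finset.mem_filter.1 hx).2 N i
      _ ≤ _ := by
          rw [Finset.sum_const, nsmul_eq_mul]
          gcongr
          have : (Finset.univ.filter (fun x : Fin α → ZMod 2 => x ≠ 0)).card ≤ 2 ^ α :=
            (Finset.card_filter_le _ _).trans (by simp)
          exact_mod_cast this
  have hP1 : P ≤ 1 := prob_le_one
  calc P = P ^ (1 : ℝ) := by simp
    -- Since `P ≤ 1`, the power only increases it, while it tempers the union bound wherever that
    -- exceeds 1.
    _ ≤ P ^ η := ENNReal.rpow_le_rpow_of_exponent_ge hP1 h1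
    _ ≤ (2 ^ α * ∑ i ∈ Finset.range L, pathWeight 2⁻¹ (Received ch τ b) N i) ^ η := by gcongr
    _ ≤ _ := by
      rw [ENNReal.mul_rpow_of_nonneg _ _ h0.le]
      gcongr
      · rw [← ENNReal.rpow_natCast, ← ENNReal.rpow_mul, mul_comm, ENNReal.rpow_mul,
          ENNReal.rpow_natCast]
      · exact (sum_rpow_le_sum_rpow h0 h1 _ _).trans
          (Finset.sum_le_sum fun i _ => pathWeight_rpow_le h0 h1 _ _ _ _)

end PathWeight

/-! ### Averaging over chunk choices and losses -/

section Skeleton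

variable {L q α : ℕ}

/-- The law of the chunks chosen by a random chunked code. -/
noncomputable def chunkLaw (L q : ℕ) : Measure (Fin L × ℕ → Fin q) :=
  Measure.infinitePi fun _ : Fin L × ℕ => uniformOn (Set.univ : Set (Fin q))

instance [NeZero q] : IsProbabilityMeasure (uniformOn (Set.univ : Set (Fin q))) :=
  isProbabilityMeasure_uniformOn Set.finite_univ Set.univ_nonempty

instance [NeZero q] : IsProbabilityMeasure (chunkLaw L q) := by
  unfold chunkLaw
  infer_instance

theorem pathWeight_congr {θ : ℝ≥0∞} {R R' : ℕ → ℕ → Prop} {t : ℕ}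
    (h : ∀ i, ∀ s < t, R i s ↔ R' i s) (i : ℕ) : pathWeight θ R t i = pathWeight θ R' t i := by
  classical
  induction t generalizing i with
  | zero => cases i <;> rfl
  | succ t ih =>
    have ih' := ih fun i s hs => h i s (hs.trans (Nat.lt_succ_self t))
    cases i <;> simp only [pathWeight, ih', h _ t (Nat.lt_succ_self t)]

theorem measurable_ite_received (b : Fin q) (i t : ℕ) (u v : ℝ≥0∞)
    [∀ y : (Fin L × ℕ → Fin q) × Traffic L, Decidable (Received y.1 y.2 b i t)] :
    Measurable fun y : (Fin L × ℕ → Fin q) × Traffic L =>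
      if Received y.1 y.2 b i t then u else v :=
  Measurable.ite (measurableSet_received b i t) measurable_const measurable_const

theorem measurable_pathWeight (θ : ℝ≥0∞) (b : Fin q) (t i : ℕ) :
    Measurable fun y : (Fin L × ℕ → Fin q) × Traffic L =>
      pathWeight θ (Received y.1 y.2 b) t i := by
  classical
  induction t generalizing i with
  | zero => cases i <;> exact measurable_const
  | succ t ih =>
    cases i with
    | zero => exact (measurable_ite_received b 0 t θ 1).mul (ih 0)
    | succ i =>
      exact ((measurable_ite_received b (i + 1) t θ 1).mul (ih (i + 1))).add
        ((measurable_ite_received b i t θ 0).mul (ih i))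

/-- The path weight at time `t` involves only earlier transmissions, hence is independent of
transmission `t`, which is received in chunk `b` with probability `p i / q`. -/
theorem lintegral_ite_received_mul_pathWeight [NeZero q] (p : Fin L → unitInterval)
    (θ u v : ℝ≥0∞) (b : Fin q) {i : ℕ} (hi : i < L) (t j : ℕ)
    [∀ y : (Fin L × ℕ → Fin q) × Traffic L, Decidable (Received y.1 y.2 b i t)] :
    ∫⁻ y, (if Received y.1 y.2 b i t then u else v) * pathWeight θ (Received y.1 y.2 b) t j
        ∂((chunkLaw L q).prod (trafficLaw p)) =
      (ENNReal.ofReal (p ⟨i, hi⟩ / q) * u + ENNReal.ofReal (1 - p ⟨i, hi⟩ / q) * v) *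
        ∫⁻ y, pathWeight θ (Received y.1 y.2 b) t j ∂((chunkLaw L q).prod (trafficLaw p)) := by
  set S : Set (Fin q × Bool) := {b} ×ˢ {true} with hS
  have hSm : MeasurableSet S := (measurableSet_singleton b).prod (measurableSet_singleton true)
  set g : Fin q × Bool → ℝ≥0∞ := fun y => S.indicator (fun _ => u) y + Sᶜ.indicator (fun _ => v) y
    with hg
  have hgm : Measurable g :=
    (measurable_const.indicator hSm).add (measurable_const.indicator hSm.compl)
  have hgR : ∀ y : (Fin L × ℕ → Fin q) × Traffic L,
      (if Received y.1 y.2 b i t then u else v) = g (y.1 (⟨i, hi⟩, t), y.2 (⟨i, hi⟩, t)) := by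
    intro y
    have hiff : Received y.1 y.2 b i t ↔ (y.1 (⟨i, hi⟩, t), y.2 (⟨i, hi⟩, t)) ∈ S := by
      simp [Received, hi, hS, and_comm]
    by_cases hr : Received y.1 y.2 b i t
    · have h' := hiff.1 hr
      simp [hg, hr, h']
    · have h' := mt hiff.2 hr
      simp [hg, hr, h']
  have hkey := lintegral_infinitePi_prod_mul_eval
    (fun _ : Fin L × ℕ => uniformOn (Set.univ : Set (Fin q)))
    (fun x : Fin L × ℕ => bernoulliMeasure true false (p x.1)) (⟨i, hi⟩, t)
    (F := fun y => pathWeight θ (Received y.1 y.2 b) t j) (g := g)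
    (measurable_pathWeight θ b t j) hgm (by
      intro ω x y
      refine pathWeight_congr (fun i' s hs => ?_) j
      simp only [Received]
      refine exists_congr fun h => ?_
      have hne : ((⟨i', h⟩, s) : Fin L × ℕ) ≠ (⟨i, hi⟩, t) :=
        fun h' => hs.ne (Prod.ext_iff.1 h').2
      rw [Function.update_of_ne hne, Function.update_of_ne hne])
  have hSp : ((uniformOn (Set.univ : Set (Fin q))).prod
      (bernoulliMeasure true false (p ⟨i, hi⟩))) S = ENNReal.ofReal (p ⟨i, hi⟩ / q) := by
    have hq : (0 : ℝ) < q := Nat.cast_pos.2 (NeZero.pos q)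
    rw [hS, Measure.prod_prod, uniformOn_univ, bernoulliMeasure_apply_of_mem_of_notMem _
      (measurableSet_singleton _) (by simp) (by simp), Measure.count_singleton, Fintype.card_fin,
      ENNReal.ofReal_div_of_pos hq, ENNReal.ofReal_natCast, ENNReal.div_eq_inv_mul,
      ENNReal.div_eq_inv_mul, mul_one, ← ENNReal.ofReal_coe_nnreal]
    rfl
  have hgi : ∫⁻ x, g x ∂((uniformOn (Set.univ : Set (Fin q))).prod
      (bernoulliMeasure true false (p ⟨i, hi⟩))) =
      ENNReal.ofReal (p ⟨i, hi⟩ / q) * u + ENNReal.ofReal (1 - p ⟨i, hi⟩ / q) * v := by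
    have h0 : 0 ≤ (p ⟨i, hi⟩ : ℝ) / q := div_nonneg (p ⟨i, hi⟩).2.1 (Nat.cast_nonneg q)
    rw [hg, lintegral_add_left (measurable_const.indicator hSm), lintegral_indicator_const hSm,
      lintegral_indicator_const hSm.compl, prob_compl_eq_one_sub hSm, hSp,
      ENNReal.ofReal_sub _ h0, ENNReal.ofReal_one, mul_comm u, mul_comm v]
  simp only [hgR]
  rw [← hgi, mul_comm (lintegral _ _) (lintegral _ _)]
  simp only [mul_comm (g _)]
  exact hkey

/-- A generating function in `z` over the position: a received packet multiplies the mass at its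
node by `θ` for staying and `θ * z` for moving, so one step costs at most `ρ` whatever the node. -/
theorem pow_mul_lintegral_pathWeight_le [NeZero q] (p : Fin L → unitInterval) {θ z ρ : ℝ≥0∞}
    (hρ : ∀ i : Fin L, ENNReal.ofReal (p i / q) * (θ * (1 + z)) + ENNReal.ofReal (1 - p i / q) ≤ ρ)
    (b : Fin q) (t : ℕ) :
    ∑ i ∈ Finset.range L, z ^ i * ∫⁻ y, pathWeight θ (Received y.1 y.2 b) t i
      ∂((chunkLaw L q).prod (trafficLaw p)) ≤ ρ ^ t := by
  classical
  rcases L with _ | n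
  · simp
  induction t with
  | zero =>
    rw [Finset.sum_range_succ']
    simp [pathWeight]
  | succ t ih =>
    set e : ℕ → ℝ≥0∞ := fun i => ∫⁻ y, pathWeight θ (Received y.1 y.2 b) t i
      ∂((chunkLaw (n + 1) q).prod (trafficLaw p)) with he
    set r : ℕ → ℝ≥0∞ := fun i => if h : i < n + 1 then ENNReal.ofReal (p ⟨i, h⟩ / q) else 0 with hr
    set s : ℕ → ℝ≥0∞ := fun i =>
      if h : i < n + 1 then ENNReal.ofReal (1 - p ⟨i, h⟩ / q) else 0 with hs
    have stay : ∀ i < n + 1, ∫⁻ y, (if Received y.1 y.2 b i t then θ else 1) *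
        pathWeight θ (Received y.1 y.2 b) t i ∂((chunkLaw (n + 1) q).prod (trafficLaw p)) =
          (r i * θ + s i) * e i := by
      intro i hi
      rw [lintegral_ite_received_mul_pathWeight p θ θ 1 b hi t i]
      simp only [hr, hs, hi, dif_pos, mul_one, he]
    have move : ∀ i < n + 1, ∫⁻ y, (if Received y.1 y.2 b i t then θ else 0) *
        pathWeight θ (Received y.1 y.2 b) t i ∂((chunkLaw (n + 1) q).prod (trafficLaw p)) =
          r i * θ * e i := by
      intro i hi
      rw [lintegral_ite_received_mul_pathWeight p θ θ 0 b hi t i]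
      simp only [hr, hi, dif_pos, mul_zero, add_zero, he]
    have e0 : ∫⁻ y, pathWeight θ (Received y.1 y.2 b) (t + 1) 0
        ∂((chunkLaw (n + 1) q).prod (trafficLaw p)) = (r 0 * θ + s 0) * e 0 := by
      simp only [pathWeight]
      exact stay 0 (Nat.succ_pos n)
    have e1 : ∀ i < n, ∫⁻ y, pathWeight θ (Received y.1 y.2 b) (t + 1) (i + 1)
        ∂((chunkLaw (n + 1) q).prod (trafficLaw p)) =
          (r (i + 1) * θ + s (i + 1)) * e (i + 1) + r i * θ * e i := by
      intro i hi
      simp only [pathWeight]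
      have hmeas : Measurable fun y : (Fin (n + 1) × ℕ → Fin q) × Traffic (n + 1) =>
          (if Received y.1 y.2 b (i + 1) t then θ else 1) *
            pathWeight θ (Received y.1 y.2 b) t (i + 1) :=
        (measurable_ite_received b (i + 1) t θ 1).mul (measurable_pathWeight θ b t (i + 1))
      rw [lintegral_add_left hmeas, stay (i + 1) (by omega), move i (by omega)]
    calc ∑ i ∈ Finset.range (n + 1), z ^ i * ∫⁻ y, pathWeight θ (Received y.1 y.2 b) (t + 1) i
          ∂((chunkLaw (n + 1) q).prod (trafficLaw p))
        = ∑ i ∈ Finset.range n, z ^ (i + 1) *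
            ((r (i + 1) * θ + s (i + 1)) * e (i + 1) + r i * θ * e i) +
              z ^ 0 * ((r 0 * θ + s 0) * e 0) := by
          rw [Finset.sum_range_succ', e0]
          congr 1
          exact Finset.sum_congr rfl fun i hi => by rw [e1 i (Finset.mem_range.1 hi)]
      _ = ∑ i ∈ Finset.range (n + 1), z ^ i * ((r i * θ + s i) * e i) +
            ∑ i ∈ Finset.range n, z ^ (i + 1) * (r i * θ * e i) := by
          rw [Finset.sum_range_succ' (fun i => z ^ i * ((r i * θ + s i) * e i))]
          simp only [mul_add, Finset.sum_add_distrib]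
          ring
      -- The move from the last node into the sink is added, so that all nodes have the same form.
      _ ≤ ∑ i ∈ Finset.range (n + 1), z ^ i * ((r i * θ + s i) * e i) +
            ∑ i ∈ Finset.range (n + 1), z ^ (i + 1) * (r i * θ * e i) := by
          gcongr
          exact Nat.le_succ n
      _ = ∑ i ∈ Finset.range (n + 1), (r i * (θ * (1 + z)) + s i) * (z ^ i * e i) := by
          rw [← Finset.sum_add_distrib]
          exact Finset.sum_congr rfl fun i _ => by ring
      _ ≤ ∑ i ∈ Finset.range (n + 1), ρ * (z ^ i * e i) := by
          refine Finset.sum_le_sum fun i hi => ?_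
          gcongr
          have hi' := Finset.mem_range.1 hi
          simpa only [hr, hs, hi', dif_pos] using hρ ⟨i, hi'⟩
      _ ≤ ρ ^ (t + 1) := by
          rw [← Finset.mul_sum, pow_succ']
          gcongr

theorem measurableSet_not_aware (b : Fin q) (N : ℕ) :
    MeasurableSet {y : ((Fin L × ℕ → Fin q) × (ℕ × Fin α → ZMod 2) ×
      (Fin L × ℕ × ℕ → ZMod 2)) × Traffic L |
        ∃ x : Fin α → ZMod 2, x ≠ 0 ∧ ¬ Aware (ChunkedCode.ofTriple y.1) y.2 b x L N} := by
  have : {y : ((Fin L × ℕ → Fin q) × (ℕ × Fin α → ZMod 2) ×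
      (Fin L × ℕ × ℕ → ZMod 2)) × Traffic L |
        ∃ x : Fin α → ZMod 2, x ≠ 0 ∧ ¬ Aware (ChunkedCode.ofTriple y.1) y.2 b x L N} =
      ⋃ x : Fin α → ZMod 2, {y | x ≠ 0 ∧ ¬ Aware (ChunkedCode.ofTriple y.1) y.2 b x L N} := by
    ext y; simp
  rw [this]
  exact MeasurableSet.iUnion fun x => (MeasurableSet.const _).inter (measurableSet_aware b x L N).compl

/-- The probability that the sink cannot decode chunk `b` at time `N`. -/
theorem pow_mul_measure_not_aware_le [NeZero q] (p : Fin L → unitInterval) {η : ℝ}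
    (h0 : 0 < η) (h1 : η ≤ 1) {z ρ : ℝ≥0∞} (hz : z ≤ 1)
    (hρ : ∀ i : Fin L, ENNReal.ofReal (p i / q) * (2⁻¹ ^ η * (1 + z)) +
      ENNReal.ofReal (1 - p i / q) ≤ ρ) (b : Fin q) (N : ℕ) :
    z ^ (L - 1) * (((chunkLaw L q).prod (coefLaw L α)).prod (trafficLaw p))
      {y | ∃ x : Fin α → ZMod 2, x ≠ 0 ∧ ¬ Aware (ChunkedCode.ofTriple y.1) y.2 b x L N} ≤
        (2 ^ η) ^ α * ρ ^ N := by
  have hm := measurableSet_not_aware (L := L) (α := α) b N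
  set B := {y : ((Fin L × ℕ → Fin q) × (ℕ × Fin α → ZMod 2) ×
      (Fin L × ℕ × ℕ → ZMod 2)) × Traffic L |
        ∃ x : Fin α → ZMod 2, x ≠ 0 ∧ ¬ Aware (ChunkedCode.ofTriple y.1) y.2 b x L N} with hB
  -- By Tonelli the coefficients are integrated first, with chunks and traffic frozen.
  have hswap : (((chunkLaw L q).prod (coefLaw L α)).prod (trafficLaw p)) B =
      ∫⁻ y, coefLaw L α {ω | ((y.1, ω), y.2) ∈ B} ∂((chunkLaw L q).prod (trafficLaw p)) := by
    have hmeas : Measurable fun y : (Fin L × ℕ → Fin q) × Traffic L =>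
        coefLaw L α {ω | ((y.1, ω), y.2) ∈ B} := by
      have : MeasurableSet {v : ((Fin L × ℕ → Fin q) × Traffic L) ×
          ((ℕ × Fin α → ZMod 2) × (Fin L × ℕ × ℕ → ZMod 2)) | ((v.1.1, v.2), v.1.2) ∈ B} :=
        (show Measurable fun v : ((Fin L × ℕ → Fin q) × Traffic L) ×
          ((ℕ × Fin α → ZMod 2) × (Fin L × ℕ × ℕ → ZMod 2)) => ((v.1.1, v.2), v.1.2) by
            fun_prop) hm
      exact measurable_measure_prodMk_left this
    rw [Measure.prod_apply hm, lintegral_prod _ (measurable_measure_prodMk_left hm).aemeasurable,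
      lintegral_prod _ hmeas.aemeasurable]
    refine lintegral_congr fun ch => ?_
    have hch : MeasurableSet {v : ((ℕ × Fin α → ZMod 2) × (Fin L × ℕ × ℕ → ZMod 2)) × Traffic L |
        ((ch, v.1), v.2) ∈ B} :=
      (show Measurable fun v : ((ℕ × Fin α → ZMod 2) × (Fin L × ℕ × ℕ → ZMod 2)) × Traffic L =>
        ((ch, v.1), v.2) by fun_prop) hm
    exact (Measure.prod_apply hch).symm.trans (Measure.prod_apply_symm hch)
  rw [hswap]
  calc z ^ (L - 1) * ∫⁻ y, coefLaw L α {ω | ((y.1, ω), y.2) ∈ B}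
        ∂((chunkLaw L q).prod (trafficLaw p))
      ≤ z ^ (L - 1) * ∫⁻ y, (2 ^ η) ^ α * ∑ i ∈ Finset.range L,
          pathWeight (2⁻¹ ^ η) (Received y.1 y.2 b) N i
            ∂((chunkLaw L q).prod (trafficLaw p)) := by
        gcongr with y
        exact coefLaw_exists_not_aware_le y.1 y.2 b N h0 h1
    _ = (2 ^ η) ^ α * ∑ i ∈ Finset.range L, z ^ (L - 1) * ∫⁻ y,
          pathWeight (2⁻¹ ^ η) (Received y.1 y.2 b) N i
            ∂((chunkLaw L q).prod (trafficLaw p)) := by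
        rw [lintegral_const_mul _ (Finset.measurable_sum _ fun i _ => measurable_pathWeight _ b N i),
          lintegral_finsetSum _ fun i _ => measurable_pathWeight _ b N i, ← Finset.mul_sum]
        ring
    _ ≤ (2 ^ η) ^ α * ∑ i ∈ Finset.range L, z ^ i * ∫⁻ y,
          pathWeight (2⁻¹ ^ η) (Received y.1 y.2 b) N i
            ∂((chunkLaw L q).prod (trafficLaw p)) := by
        gcongr 1
        refine Finset.sum_le_sum fun i hi => ?_
        gcongr ?_ * _
        have := Finset.mem_range.1 hi
        exact pow_le_pow_right_of_le_one' hz (by omega)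
    _ ≤ _ := by
        gcongr
        exact pow_mul_lintegral_pathWeight_le p hρ b N

end Skeleton

/-! ### From failure probabilities to the average delay -/

section Delay

variable {L q α : ℕ}

/-- The probability over the traffic that the sink fails to be aware at time `N` of some nonzero
vector in some chunk. -/
noncomputable def failProb (p : Fin L → unitInterval) (c : ChunkedCode L q α) (N : ℕ) : ℝ≥0∞ :=
  trafficLaw p {τ | ∃ b, ∃ x : Fin α → ZMod 2, x ≠ 0 ∧ ¬ Aware c τ b x L N}

theorem measurableSet_exists_not_aware (N : ℕ) :
    MeasurableSet {y : ((Fin L × ℕ → Fin q) × (ℕ × Fin α → ZMod 2) ×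
      (Fin L × ℕ × ℕ → ZMod 2)) × Traffic L |
        ∃ b, ∃ x : Fin α → ZMod 2, x ≠ 0 ∧ ¬ Aware (ChunkedCode.ofTriple y.1) y.2 b x L N} := by
  simp only [Set.ofPred_exists]
  exact MeasurableSet.iUnion fun b => by
    simpa only [Set.ofPred_exists] using measurableSet_not_aware (L := L) (α := α) b N

/-- After time `N`, every time step before decoding contributes 1 to the sum; without decoding the
sum is infinite. -/
theorem codingDelay_le (hL : 0 < L) (c : ChunkedCode L q α) (τ : Traffic L) (N : ℕ) :
    codingDelay c τ ≤ N + ∑' n : ℕ,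
      {τ | ∃ b, ∃ x : Fin α → ZMod 2, x ≠ 0 ∧ ¬ Aware c τ b x L (N + n)}.indicator 1 τ := by
  classical
  have hle : ∀ n, DecodedBy c τ n → codingDelay c τ ≤ n := fun n hn => iInf₂_le n hn
  have hmem : ∀ n, ¬ DecodedBy c τ (N + n) →
      τ ∈ {τ | ∃ b, ∃ x : Fin α → ZMod 2, x ≠ 0 ∧ ¬ Aware c τ b x L (N + n)} := by
    intro n hn
    by_contra h
    refine hn (decodedBy_of_aware hL fun b x hx => ?_)
    by_contra ha
    exact h ⟨b, x, hx, ha⟩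
  by_cases hex : ∃ n, DecodedBy c τ (N + n)
  · refine (hle _ (Nat.find_spec hex)).trans ?_
    push_cast
    gcongr
    calc ((Nat.find hex : ℕ) : ℝ≥0∞) = ∑ n ∈ Finset.range (Nat.find hex), 1 := by simp
      _ ≤ ∑ n ∈ Finset.range (Nat.find hex),
          {τ | ∃ b, ∃ x : Fin α → ZMod 2, x ≠ 0 ∧ ¬ Aware c τ b x L (N + n)}.indicator 1 τ := by
          refine Finset.sum_le_sum fun n hn => ?_
          rw [Set.indicator_of_mem (hmem n (Nat.find_min hex (Finset.mem_range.1 hn)))]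
          simp
      _ ≤ _ := ENNReal.sum_le_tsum _
  · have : ∀ n, {τ | ∃ b, ∃ x : Fin α → ZMod 2, x ≠ 0 ∧
        ¬ Aware c τ b x L (N + n)}.indicator (1 : Traffic L → ℝ≥0∞) τ = 1 := fun n => by
      rw [Set.indicator_of_mem (hmem n fun h => hex ⟨n, h⟩)]; rfl
    simp only [this, ENNReal.tsum_const_eq_top_of_ne_zero one_ne_zero, add_top, le_top]

theorem averageCodingDelay_le (hL : 0 < L) (p : Fin L → unitInterval) (c : ChunkedCode L q α)
    (N : ℕ) : averageCodingDelay p c ≤ N + ∑' n : ℕ, failProb p c (N + n) := by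
  have hm : ∀ n, MeasurableSet {τ : Traffic L |
      ∃ b, ∃ x : Fin α → ZMod 2, x ≠ 0 ∧ ¬ Aware c τ b x L n} := fun n =>
    (show Measurable fun τ : Traffic L => ((c.chunk, c.src, c.loc), τ) by fun_prop)
      (measurableSet_exists_not_aware n)
  calc averageCodingDelay p c ≤ ∫⁻ τ, (N : ℝ≥0∞) + ∑' n : ℕ,
        {τ | ∃ b, ∃ x : Fin α → ZMod 2, x ≠ 0 ∧ ¬ Aware c τ b x L (N + n)}.indicator 1 τ
          ∂(trafficLaw p) := lintegral_mono fun τ => codingDelay_le hL c τ N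
    _ = N + ∑' n : ℕ, failProb p c (N + n) := by
      rw [lintegral_add_left measurable_const, lintegral_const, measure_univ, mul_one,
        lintegral_tsum fun n => (measurable_one.indicator (hm (N + n))).aemeasurable]
      simp only [lintegral_indicator_one (hm _), failProb]

theorem measurable_failProb (p : Fin L → unitInterval) (N : ℕ) :
    Measurable fun c : ChunkedCode L q α => failProb p c N := by
  have h := measurable_measure_prodMk_left (ν := trafficLaw p)
    (measurableSet_exists_not_aware (L := L) (q := q) (α := α) N)
  -- The σ-algebra on codes is the image under `ChunkedCode.ofTriple`, so measurability is that of
  -- the composite.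
  exact fun s hs => h hs

theorem pow_mul_lintegral_failProb_le [NeZero q] (p : Fin L → unitInterval) {η : ℝ}
    (h0 : 0 < η) (h1 : η ≤ 1) {z ρ : ℝ≥0∞} (hz : z ≤ 1)
    (hρ : ∀ i : Fin L, ENNReal.ofReal (p i / q) * (2⁻¹ ^ η * (1 + z)) +
      ENNReal.ofReal (1 - p i / q) ≤ ρ) (N : ℕ) :
    z ^ (L - 1) * ∫⁻ c, failProb p c N ∂(codeLaw L q α) ≤ q * ((2 ^ η) ^ α * ρ ^ N) := by
  have hcode : codeLaw L q α =
      Measure.map ChunkedCode.ofTriple ((chunkLaw L q).prod (coefLaw L α)) := rfl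
  rw [hcode, lintegral_map (measurable_failProb p N) ChunkedCode.measurable_ofTriple]
  unfold failProb
  have hprod := Measure.prod_apply (μ := (chunkLaw L q).prod (coefLaw L α)) (ν := trafficLaw p)
    (measurableSet_exists_not_aware (L := L) (q := q) (α := α) N)
  refine (mul_le_mul_right hprod.symm.le _).trans ?_
  simp only [Set.ofPred_exists (fun (b : Fin q) (y : ((Fin L × ℕ → Fin q) × (ℕ × Fin α → ZMod 2) ×
      (Fin L × ℕ × ℕ → ZMod 2)) × Traffic L) =>
        ∃ x : Fin α → ZMod 2, x ≠ 0 ∧ ¬ Aware (ChunkedCode.ofTriple y.1) y.2 b x L N)]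
  calc _ ≤ z ^ (L - 1) * ∑ b : Fin q, (((chunkLaw L q).prod (coefLaw L α)).prod (trafficLaw p))
        {y | ∃ x : Fin α → ZMod 2, x ≠ 0 ∧ ¬ Aware (ChunkedCode.ofTriple y.1) y.2 b x L N} := by
        gcongr
        exact measure_iUnion_fintype_le _ _
    _ ≤ ∑ b : Fin q, (2 ^ η) ^ α * ρ ^ N := by
        rw [Finset.mul_sum]
        exact Finset.sum_le_sum fun b _ => pow_mul_measure_not_aware_le p h0 h1 hz hρ b N
    _ = _ := by simp

/-- Markov's inequality for the sum of the failure probabilities from time `N` on, whose expectation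
is bounded by a geometric series. -/
theorem pow_mul_codeLaw_averageCodingDelay_le [NeZero q] (hL : 0 < L) (p : Fin L → unitInterval)
    {η : ℝ} (h0 : 0 < η) (h1 : η ≤ 1) {z ρ : ℝ≥0∞} (hz : z ≤ 1)
    (hρ : ∀ i : Fin L, ENNReal.ofReal (p i / q) * (2⁻¹ ^ η * (1 + z)) +
      ENNReal.ofReal (1 - p i / q) ≤ ρ) (N : ℕ) (m : ℝ≥0∞) :
    z ^ (L - 1) * (m * codeLaw L q α {c | N + m < averageCodingDelay p c}) ≤
      q * ((2 ^ η) ^ α * (ρ ^ N * (1 - ρ)⁻¹)) := by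
  have hmeas : Measurable fun c : ChunkedCode L q α => ∑' n : ℕ, failProb p c (N + n) :=
    Measurable.tsum fun n => measurable_failProb p (N + n)
  calc z ^ (L - 1) * (m * codeLaw L q α {c | N + m < averageCodingDelay p c})
      ≤ z ^ (L - 1) * (m * codeLaw L q α {c | m ≤ ∑' n : ℕ, failProb p c (N + n)}) := by
        gcongr with c
        intro hc
        have := hc.le.trans (averageCodingDelay_le hL p c N)
        exact (ENNReal.add_le_add_iff_left (ENNReal.natCast_ne_top N)).1 this
    _ ≤ z ^ (L - 1) * ∫⁻ c, ∑' n : ℕ, failProb p c (N + n) ∂(codeLaw L q α) := by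
        gcongr
        exact mul_meas_ge_le_lintegral hmeas m
    _ = ∑' n : ℕ, z ^ (L - 1) * ∫⁻ c, failProb p c (N + n) ∂(codeLaw L q α) := by
        rw [lintegral_tsum fun n => (measurable_failProb p (N + n)).aemeasurable,
          ENNReal.tsum_mul_left]
    _ ≤ ∑' n : ℕ, q * ((2 ^ η) ^ α * (ρ ^ N * ρ ^ n)) := by
        refine ENNReal.tsum_le_tsum fun n => ?_
        rw [← pow_add]
        exact pow_mul_lintegral_failProb_le p h0 h1 hz hρ (N + n)
    _ = _ := by
        rw [ENNReal.tsum_mul_left, ENNReal.tsum_mul_left, ENNReal.tsum_mul_left,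
          ENNReal.tsum_geometric]

end Delay

/-! ### An explicit bound by choice of parameters -/

section FiniteBound

/-- This is `u ≤ sinh u` at `u = log (1 + t)`; it makes the Chernoff exponent quadratic. -/
theorem half_sq_div_le_sub_log {t : ℝ} (ht : 0 ≤ t) : t ^ 2 / (2 * (1 + t)) ≤ t - Real.log (1 + t) := by
  have hlog : Real.log (1 + t) ≤ (1 + t - (1 + t)⁻¹) / 2 := by
    have h1 : (0 : ℝ) < 1 + t := by linarith
    have := Real.self_le_sinh_iff.2 (Real.log_nonneg (by linarith : (1 : ℝ) ≤ 1 + t))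
    rwa [Real.sinh_log h1] at this
  have : t - (1 + t - (1 + t)⁻¹) / 2 = t ^ 2 / (2 * (1 + t)) := by
    have : (1 + t) ≠ 0 := by linarith
    field_simp
    ring
  linarith

variable {L q α : ℕ}

theorem codeLaw_averageCodingDelay_le_real [NeZero q] (hL : 0 < L) (p : Fin L → unitInterval)
    {pm θ z m : ℝ} (hpm : 0 < pm) (hp : ∀ i, pm ≤ p i) (hpm1 : pm ≤ 1)
    (hθ : 1 / 2 ≤ θ) (hz0 : 0 < z) (hz1 : z ≤ 1) (hθz : θ * (1 + z) < 1) (hm : 0 < m) (N : ℕ) :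
    codeLaw L q α {c | N + ENNReal.ofReal m < averageCodingDelay p c} ≤
      ENNReal.ofReal (q * (θ⁻¹ ^ α * ((1 - pm / q * (1 - θ * (1 + z))) ^ N *
        (pm / q * (1 - θ * (1 + z)))⁻¹)) / (z ^ (L - 1) * m)) := by
  have hq : (1 : ℝ) ≤ q := by exact_mod_cast NeZero.one_le
  have hθ0 : 0 < θ := by linarith
  have hθ1 : θ < 1 := by nlinarith
  have hinv : 1 < θ⁻¹ := (one_lt_inv₀ hθ0).2 hθ1
  have hinv2 : θ⁻¹ ≤ 2 := by rw [inv_le_comm₀ hθ0 two_pos]; linarith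
  -- Thus `θ = 2 ^ (-η)`, and `1 / 2 ≤ θ` is exactly `η ≤ 1`.
  set η := Real.logb 2 θ⁻¹ with hη
  have h0 : 0 < η := Real.logb_pos one_lt_two hinv
  have h1 : η ≤ 1 := by
    rw [hη, Real.logb_le_iff_le_rpow one_lt_two (by positivity)]; simpa using hinv2
  have h2η : (2 : ℝ≥0∞) ^ η = ENNReal.ofReal θ⁻¹ := by
    rw [← ENNReal.ofReal_ofNat, ENNReal.ofReal_rpow_of_pos two_pos, hη,
      Real.rpow_logb two_pos (by norm_num) (by positivity)]
  have h2η' : (2⁻¹ : ℝ≥0∞) ^ η = ENNReal.ofReal θ := by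
    rw [ENNReal.inv_rpow, h2η, ENNReal.ofReal_inv_of_pos hθ0, inv_inv]
  set κ := θ * (1 + z) with hκ
  set r := pm / q with hr
  have hr0 : 0 < r := by positivity
  have hr1 : r ≤ 1 := (div_le_one (by linarith)).2 (by linarith)
  have hκ0 : 0 < κ := by positivity
  have hd0 : 0 < r * (1 - κ) := mul_pos hr0 (by linarith)
  have hρ0 : 0 ≤ 1 - r * (1 - κ) := by nlinarith
  have hkey := pow_mul_codeLaw_averageCodingDelay_le (α := α) hL p h0 h1
    (z := ENNReal.ofReal z) (ρ := ENNReal.ofReal (1 - r * (1 - κ)))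
    (ENNReal.ofReal_le_one.2 hz1) (by
      intro i
      have hi0 : 0 ≤ (p i : ℝ) / q := div_nonneg (p i).2.1 (by linarith)
      have hi1 : (p i : ℝ) / q ≤ 1 := (div_le_one (by linarith)).2 ((p i).2.2.trans hq)
      have hri : r ≤ (p i : ℝ) / q := by rw [hr]; gcongr; exact hp i
      rw [h2η', ← ENNReal.ofReal_one, ← ENNReal.ofReal_add zero_le_one hz0.le,
        ← ENNReal.ofReal_mul hθ0.le, ← ENNReal.ofReal_mul hi0,
        ← ENNReal.ofReal_add (by positivity) (by linarith)]
      apply ENNReal.ofReal_le_ofReal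
      nlinarith) N (ENNReal.ofReal m)
  have hconv : (q : ℝ≥0∞) * ((2 ^ η) ^ α * (ENNReal.ofReal (1 - r * (1 - κ)) ^ N *
      (1 - ENNReal.ofReal (1 - r * (1 - κ)))⁻¹)) =
      ENNReal.ofReal (q * (θ⁻¹ ^ α * ((1 - r * (1 - κ)) ^ N * (r * (1 - κ))⁻¹))) := by
    generalize r * (1 - κ) = d at hρ0 hd0 ⊢
    rw [h2η, ← ENNReal.ofReal_one, ← ENNReal.ofReal_sub _ hρ0, sub_sub_cancel,
      ENNReal.ofReal_mul (by positivity), ENNReal.ofReal_mul (by positivity),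
      ENNReal.ofReal_mul (by positivity), ENNReal.ofReal_pow (by positivity),
      ENNReal.ofReal_pow hρ0, ENNReal.ofReal_inv_of_pos hd0, ENNReal.ofReal_natCast]
  rw [hconv, ← ENNReal.ofReal_pow hz0.le, ← mul_assoc, ← ENNReal.ofReal_mul (by positivity),
    mul_comm] at hkey
  rw [ENNReal.ofReal_div_of_pos (by positivity)]
  refine (ENNReal.le_div_iff_mul_le (Or.inl ?_) (Or.inl ENNReal.ofReal_ne_top)).2 hkey
  simp only [ne_eq, ENNReal.ofReal_eq_zero, not_le]
  positivity

/-- An explicit bound for the probability that the average coding delay is large. -/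
theorem codeLaw_averageCodingDelay_le_of_sq [NeZero q] (hL : 0 < L) (p : Fin L → unitInterval)
    {pm y ε : ℝ} (hpm : 0 < pm) (hp : ∀ i, pm ≤ p i) (hpm1 : pm ≤ 1) (hα : 4 ≤ α)
    (hy2 : 2 ≤ y) (hyα : y ≤ α / 4) (hε0 : 0 < ε) (hε1 : ε < 1)
    (hsq : 1 + L * Real.log ((q * α : ℕ) * L / ε) ≤ y ^ 2 / (2 * (α + y))) :
    codeLaw L q α {c | ENNReal.ofReal ((α + y + 2) * (q / pm)) < averageCodingDelay p c} ≤
      ENNReal.ofReal ε := by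
  have hq : (1 : ℝ) ≤ q := by exact_mod_cast NeZero.one_le
  have hL1 : (1 : ℝ) ≤ L := by exact_mod_cast hL
  have hα' : (4 : ℝ) ≤ α := by exact_mod_cast hα
  have hα0 : (0 : ℝ) < α := by linarith
  have hqp : 1 ≤ (q : ℝ) / pm := (one_le_div hpm).2 (by linarith)
  have hay : (0 : ℝ) < α + y := by linarith
  -- With this `z`, `(1 + z) ^ α` stays below `e`, while `z ^ (L - 1)` costs only a factor `α ^ (L -
  -- 1)`.
  set z : ℝ := 1 / α with hz
  have hz0 : 0 < z := by positivity
  have hz1 : z ≤ 1 / 4 := by rw [hz]; gcongr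
  -- The value `κ = α / (α + y)` of `θ * (1 + z)` minimizes `κ ^ (-α) * exp (-(α + y) * (1 - κ))`.
  set θ : ℝ := α / (α + y) / (1 + z) with hθ
  have hθz : θ * (1 + z) = α / (α + y) := by
    rw [hθ, div_mul_cancel₀]; positivity
  have hθ2 : 1 / 2 ≤ θ := by
    rw [hθ, le_div_iff₀ (by positivity)]
    have : (4 : ℝ) / 5 ≤ α / (α + y) := by
      rw [div_le_div_iff₀ (by norm_num) hay]; linarith
    linarith
  have hlt : θ * (1 + z) < 1 := by
    rw [hθz, div_lt_one hay]; linarith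
  set N := ⌈(α + y) * (q / pm)⌉₊ with hN
  have hNle : (N : ℝ) ≤ (α + y) * (q / pm) + 1 := (Nat.ceil_lt_add_one (by positivity)).le
  have hNge : (α + y) * (q / pm) ≤ N := Nat.le_ceil _
  have hbound := codeLaw_averageCodingDelay_le_real (q := q) (α := α) hL p hpm hp hpm1 hθ2 hz0
    (by linarith) hlt (m := q / pm) (by positivity) N
  refine (measure_mono fun c hc => ?_).trans (hbound.trans (ENNReal.ofReal_le_ofReal ?_))
  · rw [Set.mem_ofPred_eq] at hc ⊢
    refine lt_of_le_of_lt ?_ hc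
    rw [← ENNReal.ofReal_natCast, ← ENNReal.ofReal_add (by positivity) (by positivity)]
    apply ENNReal.ofReal_le_ofReal
    -- The summand 2 pays for rounding `N` up, as `1 ≤ q / pm`, and for the Markov threshold `q /
    -- pm`.
    nlinarith
  have h1θ : 1 - θ * (1 + z) = y / (α + y) := by
    rw [hθz]; field_simp; ring
  rw [h1θ]
  have hle1 : pm / q * (y / (α + y)) ≤ 1 := by
    have e1 : pm / q ≤ 1 := (div_le_one (by linarith)).2 (by linarith)
    have e2 : y / (α + y) ≤ 1 := (div_le_one hay).2 (by linarith)
    have : 0 ≤ y / (α + y) := by positivity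
    nlinarith
  have hb0 : 0 ≤ (1 - pm / q * (y / (α + y))) ^ N := pow_nonneg (by linarith) N
  have hpow : (1 - pm / q * (y / (α + y))) ^ N ≤ Real.exp (-y) := by
    calc (1 - pm / q * (y / (α + y))) ^ N ≤ Real.exp (-(pm / q * (y / (α + y)))) ^ N := by
          apply pow_le_pow_left₀ (by linarith)
          have := Real.add_one_le_exp (-(pm / q * (y / (α + y))))
          linarith
      _ = Real.exp (-(N * (pm / q * (y / (α + y))))) := by
          rw [← Real.exp_nat_mul]; congr 1; ring
      _ ≤ Real.exp (-y) := by
          apply Real.exp_le_exp.2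
          have e : (α + y) * (q / pm) * (pm / q * (y / (α + y))) = y := by field_simp
          have : (α + y) * (q / pm) * (pm / q * (y / (α + y))) ≤ N * (pm / q * (y / (α + y))) := by
            gcongr
          linarith
  have hθα : θ⁻¹ ^ α ≤ Real.exp 1 * Real.exp (α * Real.log (1 + y / α)) := by
    have e : θ⁻¹ = (1 + z) * (1 + y / α) := by
      rw [hθ]; field_simp
    rw [e, mul_pow]
    gcongr
    · calc (1 + z) ^ α ≤ Real.exp z ^ α := by
            gcongr
            have := Real.add_one_le_exp z
            linarith
        _ = Real.exp 1 := by
            rw [← Real.exp_nat_mul, hz]; congr 1; field_simp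
    · rw [mul_comm, Real.exp_mul, Real.exp_log (by positivity), Real.rpow_natCast]
  have hfrac : (pm / q * (y / (α + y)))⁻¹ / (z ^ (L - 1) * (q / pm)) ≤ (α : ℝ) ^ L := by
    have e : (pm / q * (y / (α + y)))⁻¹ / (z ^ (L - 1) * (q / pm)) =
        (α + y) / y * (α : ℝ) ^ (L - 1) := by
      rw [hz, one_div, inv_pow]; field_simp
    have e2 : (α + y) / y ≤ α := by
      rw [div_le_iff₀ (by linarith)]; nlinarith
    rw [e]
    calc (α + y) / y * (α : ℝ) ^ (L - 1) ≤ α * (α : ℝ) ^ (L - 1) := by gcongr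
      _ = (α : ℝ) ^ L := by rw [← pow_succ', Nat.sub_add_cancel hL]
  have hqL : (q : ℝ) ≤ (q : ℝ) ^ L := le_self_pow₀ hq hL.ne'
  set K : ℝ := ((q * α : ℕ) : ℝ) * L / ε with hK
  have hkpos : (0 : ℝ) < (q * α : ℕ) := by push_cast; positivity
  have hK0 : 0 < K := by positivity
  have hexp : α * Real.log (1 + y / α) - y ≤ -(y ^ 2 / (2 * (α + y))) := by
    have h := half_sq_div_le_sub_log (t := y / α) (by positivity)
    have e : α * ((y / α) ^ 2 / (2 * (1 + y / α))) = y ^ 2 / (2 * (α + y)) := by field_simp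
    have e' : α * (y / α - Real.log (1 + y / α)) = y - α * Real.log (1 + y / α) := by
      field_simp
    have := mul_le_mul_of_nonneg_left h hα0.le
    rw [e, e'] at this
    linarith
  -- The exponent will cancel `K ^ L`, so one factor `ε` has to be left over.
  have hKL : ((q * α : ℕ) : ℝ) ^ L ≤ ε * K ^ L := by
    have e : ((q * α : ℕ) : ℝ) ≤ K * ε := by
      rw [hK, div_mul_cancel₀ _ hε0.ne']
      nlinarith
    calc ((q * α : ℕ) : ℝ) ^ L ≤ (K * ε) ^ L := by gcongr
      _ = K ^ L * ε ^ L := mul_pow _ _ _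
      _ ≤ K ^ L * ε := by
          gcongr
          exact pow_le_of_le_one hε0.le hε1.le hL.ne'
      _ = ε * K ^ L := mul_comm _ _
  have hw0 : 0 ≤ (pm / q * (y / (α + y)))⁻¹ / (z ^ (L - 1) * (q / pm)) := by
    have : 0 < y := by linarith
    positivity
  calc q * (θ⁻¹ ^ α * ((1 - pm / q * (y / (α + y))) ^ N * (pm / q * (y / (α + y)))⁻¹)) /
        (z ^ (L - 1) * (q / pm))
      = q * (θ⁻¹ ^ α * (1 - pm / q * (y / (α + y))) ^ N *
          ((pm / q * (y / (α + y)))⁻¹ / (z ^ (L - 1) * (q / pm)))) := by ring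
    _ ≤ q ^ L * (Real.exp 1 * Real.exp (α * Real.log (1 + y / α)) * Real.exp (-y) * α ^ L) := by
        gcongr
    _ = ((q * α : ℕ) : ℝ) ^ L * Real.exp (1 + (α * Real.log (1 + y / α) - y)) := by
        rw [← Real.exp_add, ← Real.exp_add]
        push_cast
        rw [mul_pow, show 1 + α * Real.log (1 + y / α) + -y = 1 + (α * Real.log (1 + y / α) - y) by
          ring]
        ring
    _ ≤ ε * K ^ L * Real.exp (-(L * Real.log K)) := by
        gcongr
        linarith
    _ = ε := by
        rw [Real.exp_neg, Real.exp_nat_mul, Real.exp_log hK0, mul_assoc,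
          mul_inv_cancel₀ (by positivity), mul_one]

end FiniteBound

/-! ### Comparison of the explicit bound with the asymptotic one -/

section Asymptotics

/-- The third part of the logarithm of `X` is a lower bound for the logarithm of `w q L / ε`. -/
theorem third_logb_le_logb {q α L ε w l X : ℝ} (hq : 1 ≤ q) (hα : 0 < α) (hL : 1 ≤ L)
    (hε0 : 0 < ε) (hε1 : ε < 1) (hX : X = q * α * L / ε) (hl : l = Real.logb 2 X) (hl0 : 0 < l)
    (hll : 1 + Real.logb 2 l ≤ l / 3) (hw : 99 / 100 * √(α * L / l) ≤ w) :
    l / 3 ≤ Real.logb 2 (w * q * L / ε) := by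
  have hX0 : 0 < X := by rw [hX]; positivity
  have hw0 : 0 < w := lt_of_lt_of_le (by positivity) hw
  -- Squaring removes the root in `w`; the factor 2 absorbs `(99 / 100) ^ 2`. Then twice the
  -- logarithm is at least `l - 1 - log l`, hence at least `2 * l / 3`.
  have hsq : X / (2 * l) ≤ (w * q * L / ε) ^ 2 := by
    have h1 : (99 / 100) ^ 2 * (α * L / l) ≤ w ^ 2 := by
      calc (99 / 100) ^ 2 * (α * L / l) = (99 / 100 * √(α * L / l)) ^ 2 := by
            rw [mul_pow, Real.sq_sqrt (by positivity)]
        _ ≤ w ^ 2 := by gcongr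
    have h2 : 1 ≤ q * L ^ 2 / ε := by
      rw [one_le_div hε0]
      nlinarith [one_le_pow₀ hL (n := 2)]
    have hXl : 0 < X / l := by positivity
    calc X / (2 * l) = 1 / 2 * (X / l) := by field_simp
      _ ≤ (99 / 100) ^ 2 * (X / l) * (q * L ^ 2 / ε) := by nlinarith
      _ = (99 / 100) ^ 2 * (α * L / l) * (q * L / ε) ^ 2 := by rw [hX]; field_simp
      _ ≤ w ^ 2 * (q * L / ε) ^ 2 := by gcongr
      _ = _ := by ring
  have hlog := Real.logb_le_logb_of_le one_lt_two (by positivity) hsq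
  rw [Real.logb_pow, Real.logb_div hX0.ne' (by positivity),
    Real.logb_mul two_ne_zero hl0.ne', Real.logb_self_eq_one one_lt_two, ← hl] at hlog
  push_cast at hlog
  linarith

/-- At the ideal `w` the first term equals `S` and the second is at least `S / 3`; an error of one
percent in `w` leaves 0.99 + 0.33. -/
theorem thirteen_tenths_le {α L w S l lam : ℝ} (hα : 0 < α) (hL : 0 < L) (hl : 0 < l)
    (hS : S = √(α * L * l)) (hw1 : 99 / 100 * √(α * L / l) ≤ w)
    (hw2 : w ≤ 101 / 100 * √(α * L / l)) (hlam : l / 3 ≤ lam) :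
    13 / 10 * S ≤ α * L / w + w * lam := by
  set w₀ := √(α * L / l) with hw₀
  have hw₀0 : 0 < w₀ := Real.sqrt_pos.2 (by positivity)
  have hw0 : 0 < w := lt_of_lt_of_le (by positivity) hw1
  have hsq : w₀ ^ 2 = α * L / l := Real.sq_sqrt (by positivity)
  have hS' : S = w₀ * l := by
    rw [hS, Real.sqrt_eq_iff_mul_self_eq (by positivity) (by positivity)]
    have : w₀ ^ 2 * l = α * L := by rw [hsq]; field_simp
    linear_combination -l * this
  have h1 : 99 / 100 * S ≤ α * L / w := by
    rw [le_div_iff₀ hw0, hS']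
    have : w₀ ^ 2 * l = α * L := by rw [hsq]; field_simp
    calc 99 / 100 * (w₀ * l) * w ≤ 99 / 100 * (w₀ * l) * (101 / 100 * w₀) := by gcongr
      _ ≤ α * L := by nlinarith [mul_pos hα hL]
  have h2 : 99 / 100 * w₀ * (l / 3) ≤ w * lam := by gcongr
  rw [hS'] at h1 ⊢
  nlinarith [mul_pos hw₀0 hl]

/-- The numerical margin is `0.8 * 2 * 1.02 < 1.29 ^ 2`, where 0.8 exceeds `log 2` by enough to
absorb the summand 1. The `-2` in `y` offsets the `+2` of the explicit bound. -/
theorem one_add_mul_log_le {α L l S y X : ℝ} (hα : 0 < α) (hL : 1 ≤ L) (hl : 10 ≤ l)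
    (hlX : l = Real.logb 2 X) (hLl : 10000 * (L * l) ≤ α) (hS : S = √(α * L * l))
    (hy : y = 13 / 10 * S - 2) :
    2 ≤ y ∧ y ≤ α / 4 ∧ 1 + L * Real.log X ≤ y ^ 2 / (2 * (α + y)) := by
  have hLl0 : 10 ≤ L * l := by nlinarith
  have hS0 : 0 ≤ S := hS ▸ Real.sqrt_nonneg _
  have hSsq : S ^ 2 = α * L * l := by rw [hS, Real.sq_sqrt (by positivity)]
  have hS1 : S ≤ α / 100 := by
    apply le_of_sq_le_sq _ (by positivity)
    rw [hSsq]
    nlinarith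
  have hS2 : 1000 ≤ S := by
    apply le_of_sq_le_sq _ hS0
    rw [hSsq]
    nlinarith
  have hlog : Real.log X = l * Real.log 2 := by
    rw [hlX, Real.logb, div_mul_cancel₀]
    exact (Real.log_pos one_lt_two).ne'
  have hy1 : 129 / 100 * S ≤ y := by linarith
  refine ⟨by linarith, by linarith, ?_⟩
  rw [le_div_iff₀ (by linarith), hlog]
  have hlog2 := Real.log_two_lt_d9
  have hA : 1 + L * (l * Real.log 2) ≤ 8 / 10 * (L * l) := by nlinarith
  calc (1 + L * (l * Real.log 2)) * (2 * (α + y)) ≤ 8 / 10 * (L * l) * (2 * (α + α / 50)) := by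
        have hy3 : y ≤ α / 50 := by linarith
        have hy0 : 0 ≤ α + y := by linarith
        gcongr
    _ ≤ (129 / 100) ^ 2 * (α * L * l) := by nlinarith [mul_pos hα (by linarith : 0 < L * l)]
    _ = (129 / 100 * S) ^ 2 := by rw [← hSsq]; ring
    _ ≤ y ^ 2 := by gcongr

end Asymptotics

/-! ### The limit theorem -/

theorem mainTheorem4
    (k L q α : ℕ → ℕ) (p : (n : ℕ) → Fin (L n) → unitInterval) (ε w : ℕ → ℝ)
    (hk : Tendsto k atTop atTop)
    (hchunk : ∀ n, k n = q n * α n)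
    (hL : ∀ n, 0 < L n)
    (hp : ∀ n i, 0 < p n i)
    (hε : ∀ n, 0 < ε n ∧ ε n < 1)
    (hq : Tendsto (fun n => (q n : ℝ) / (k n / (L n * Real.logb 2 (k n * L n / ε n))))
      atTop (𝓝 0))
    (hw : Tendsto (fun n => w n / √(k n * L n / (q n * Real.logb 2 (k n * L n / ε n))))
      atTop (𝓝 1)) :
    ∃ δ : ℕ → ℝ, Tendsto δ atTop (𝓝 0) ∧
      ∀ᶠ n in atTop,
        codeLaw (L n) (q n) (α n)
          {c | ENNReal.ofReal (1 / (⨅ i, (p n i : ℝ)) *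
              (k n + (1 + δ n) *
                (k n * L n / w n + w n * q n * Real.logb 2 (w n * q n * L n / ε n))))
            < averageCodingDelay (p n) c}
          ≤ ENNReal.ofReal (ε n) := by
  -- The surplus of 1.3 over `√(2 ln 2)` makes any correction unnecessary.
  refine ⟨fun _ => 0, tendsto_const_nhds, ?_⟩
  have hkR : Tendsto (fun n => (k n : ℝ)) atTop atTop := tendsto_natCast_atTop_atTop.comp hk
  have hX : Tendsto (fun n => (k n * L n / ε n : ℝ)) atTop atTop := by
    refine tendsto_atTop_mono (fun n => ?_) hkR
    have hL1 : (1 : ℝ) ≤ L n := by exact_mod_cast hL n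
    rw [le_div_iff₀ (hε n).1]
    have : (0 : ℝ) ≤ k n := Nat.cast_nonneg _
    nlinarith [(hε n).2]
  have hl : Tendsto (fun n => Real.logb 2 (k n * L n / ε n)) atTop atTop :=
    (Real.tendsto_logb_atTop one_lt_two).comp hX
  have hll : ∀ᶠ l : ℝ in atTop, 1 + Real.logb 2 l ≤ l / 3 := by
    have h1 : ∀ᶠ l : ℝ in atTop, ‖Real.log l‖ ≤ (Real.log 2 / 6) * ‖l‖ :=
      Real.isLittleO_log_id_atTop.bound (by have := Real.log_pos one_lt_two; positivity)
    filter_upwards [h1, eventually_ge_atTop 6] with l h1 h6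
    have h2 := Real.log_pos one_lt_two
    have : Real.logb 2 l ≤ l / 6 := by
      rw [Real.logb, div_le_iff₀ h2]
      calc Real.log l ≤ ‖Real.log l‖ := le_abs_self _
        _ ≤ (Real.log 2 / 6) * ‖l‖ := h1
        _ = l / 6 * Real.log 2 := by rw [Real.norm_of_nonneg (by linarith)]; ring
    linarith
  filter_upwards [hk.eventually_ge_atTop 1, hl.eventually hll, hl.eventually_ge_atTop 10,
    hq.eventually_le_const (show (0 : ℝ) < 1 / 10000 by norm_num),
    hw.eventually_const_le (show (99 / 100 : ℝ) < 1 by norm_num),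
    hw.eventually_le_const (show (1 : ℝ) < 101 / 100 by norm_num)]
    with n hk1 hlln hl10 hqn hw1 hw2
  obtain ⟨hε0, hε1⟩ := hε n
  have hkn := hchunk n
  have hqpos : 0 < q n := Nat.pos_of_ne_zero fun h => by simp [h] at hkn; omega
  have hαpos : 0 < α n := Nat.pos_of_ne_zero fun h => by simp [h] at hkn; omega
  have : NeZero (q n) := ⟨hqpos.ne'⟩
  have hq1 : (1 : ℝ) ≤ q n := by exact_mod_cast hqpos
  have hα0 : (0 : ℝ) < α n := by exact_mod_cast hαpos
  have hL1 : (1 : ℝ) ≤ L n := by exact_mod_cast hL n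
  have hkqα : (k n : ℝ) = q n * α n := by exact_mod_cast hkn
  set X : ℝ := k n * L n / ε n with hXdef
  set l : ℝ := Real.logb 2 X with hldef
  have hl0 : 0 < l := by linarith
  have hw₀ : (k n * L n / (q n * l) : ℝ) = α n * L n / l := by
    rw [hkqα]; field_simp
  rw [hw₀] at hw1 hw2
  have hsqrt : 0 < √(α n * L n / l) := Real.sqrt_pos.2 (by positivity)
  rw [le_div_iff₀ hsqrt] at hw1
  rw [div_le_iff₀ hsqrt] at hw2
  have hw0 : 0 < w n := lt_of_lt_of_le (by positivity) hw1
  -- The hypothesis on `q` says that `L * l / α` tends to 0; this makes `S` at most `α / 100`.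
  have hLl : 10000 * (L n * l) ≤ α n := by
    have e : (q n : ℝ) / (k n / (L n * l)) = L n * l / α n := by
      rw [hkqα]; field_simp
    rw [e, div_le_iff₀ hα0] at hqn
    linarith
  obtain ⟨hy2, hyα, hsq⟩ := one_add_mul_log_le hα0 hL1 hl10 hldef hLl rfl rfl
  set S := √(α n * L n * l) with hS
  have hα4 : 4 ≤ α n := by
    have : (4 : ℝ) ≤ α n := by nlinarith
    exact_mod_cast this
  have hlam := third_logb_le_logb hq1 hα0 hL1 hε0 hε1 (by rw [hXdef, hkqα]) hldef hl0 hlln hw1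
  have hD := thirteen_tenths_le hα0 (by linarith) hl0 hS hw1 hw2 hlam
  have : Nonempty (Fin (L n)) := ⟨⟨0, hL n⟩⟩
  set pm : ℝ := ⨅ i, (p n i : ℝ) with hpm
  have hpm0 : 0 < pm := by
    obtain ⟨i, hi⟩ := exists_eq_ciInf_of_finite (f := fun i => (p n i : ℝ))
    rw [hpm, ← hi]
    exact hp n i
  have hpmle : ∀ i, pm ≤ p n i := fun i => ciInf_le (Set.finite_range _).bddBelow i
  have hpm1 : pm ≤ 1 := (hpmle ⟨0, hL n⟩).trans (p n ⟨0, hL n⟩).2.2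
  refine (measure_mono fun c hc => ?_).trans
    (codeLaw_averageCodingDelay_le_of_sq (hL n) (p n) hpm0 hpmle hpm1 hα4 hy2 hyα hε0 hε1
      (by rw [← hkn]; exact hsq))
  rw [Set.mem_ofPred_eq] at hc ⊢
  refine lt_of_le_of_lt (ENNReal.ofReal_le_ofReal ?_) hc
  have e : 1 / pm * (k n + (1 + 0) * (k n * L n / w n + w n * q n *
      Real.logb 2 (w n * q n * L n / ε n))) =
      (α n + (α n * L n / w n + w n * Real.logb 2 (w n * q n * L n / ε n))) * (q n / pm) := by
    rw [hkqα]; field_simp; ring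
  rw [e]
  refine mul_le_mul_of_nonneg_right ?_ (by positivity)
  linarith
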